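/- **Overture.** Work over $\mathbb{F}_2$, writing $\mathtt{xor}$ for $+$, $\mathtt{and}$ for multiplication and $\mathtt{true}=1$, $\mathtt{false}=0$. Clients are natural numbers. A protocol $\pi$ is a finite sequence of commands $m[w]@\iota_2 := \varepsilon@\iota_1$ (client $\iota_1$ computes $\varepsilon$ and sends it to $\iota_2$), $p[w] := \varepsilon@\iota$ (public reveal by $\iota$), $\mathsf{out}@\iota := \varepsilon@\iota$ (output of $\iota$). Expressions $\varepsilon$ are built from constants, $s[w]$ (secrets), $r[w]$ (random samples), $m[w]$, $p[w]$, the field operations, and oblivious transfer $\mathrm{OT}(\varepsilon_1@\iota',\varepsilon_2,\varepsilon_3)$. When client $\iota$ evaluates an expression, $s[w], r[w], m[w]$ denote the variables $s[w]@\iota$, $r[w]@\iota$, $m[w]@\iota$, and $\mathrm{OT}(\varepsilon_1@\iota',\varepsilon_2,\varepsilon_3)$ is $\varepsilon_2$ if the value of $\varepsilon_1$ at client $\iota'$ is $1$, and $\varepsilon_3$ otherwise. Commands are executed in order on finite partial memories from variables to $\mathbb{F}_2$; a command can only assign a variable that is not yet defined, and its expression may only use defined variables. Let $S,R,V,O$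 be the sets of secret variables, random variables, views (message and public variables) and output variables of $\pi$, and $\mathrm{mems}(X)$ the set of memories with domain $X$. Let $\mathrm{runs}(\pi)$ be the set of final memories of complete executions of $\pi$ from initial memories in $\mathrm{mems}(S\cup R)$, and let $\mathrm{BD}(\pi)$ be the distribution on $\mathrm{mems}(S\cup V\cup O\cup R)$ giving each element of $\mathrm{runs}(\pi)$ probability $1/|\mathrm{runs}(\pi)|$ and all other memories $0$. **Noninterference modulo output.** For a set of variables $X$ and a set of clients $I$, $X_I$ is the set of those variables in $X$ owned by a client in $I$. Given a partition of the federation into honest clients $H$ and corrupt clients $C$, the corrupt views $V_{H\rhd C}$ are the variables $p[w]$ revealed by clients in $H$ and the variables $m[w]@\iota$ with $\iota\in C$ sent by clients in $H$. The protocol $\pi$ satisfies *noninterference modulo output* iff for all such $H, C$, all $m_1\in\mathrm{mems}(S_C\cup O)$ and all $m_2\in\mathrm{mems}(V_{H\rhd C})$ such that $m_1\uplus m_2$ has positive marginal probability in $\mathrm{BD}(\pi)$, $$\mathrm{BD}(\pi)(S_H\mid m_1)=\mathrm{BD}(\pi)(S_H\mid m_1\uplus m_2)$$ as conditional distributions on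 $\mathrm{mems}(S_H)$. **Prelude and GMW circuits.** Prelude is a call-by-value, left-to-right metalanguage with let-bindings, sequencing, records and first-order functions, whose values are identifier strings, client ids, Overture expressions, the unit value $()$ and records of values; evaluating a concrete Overture command appends it to the residual protocol and returns $()$. We write $(\varnothing,e)\to^*(\pi,())$ if $e$ evaluates to $()$ with residual protocol $\pi$. The two-party GMW library (federation $\{1,2\}$) consists of the following functions, where $\mathtt{and}$ binds tighter than $\mathtt{xor}$: - $\mathtt{encodegmw}(in,i_1,i_2)$: $m[in]@i_2 := (s[in]\ \mathtt{xor}\ r[in])@i_2;\ m[in]@i_1 := r[in]@i_2;\ m[in]$ - $\mathtt{andtablegmw}(b_1,b_2,r)$: the record with $\mathtt{row1},\mathtt{row2},\mathtt{row3},\mathtt{row4}$ equal to $r\ \mathtt{xor}\ (b_1\ \mathtt{xor}\ c_1)\ \mathtt{and}\ (b_2\ \mathtt{xor}\ c_2)$ for $(c_1,c_2)=(1,1),(1,0),(0,1),(0,0)$ respectively - $\mathtt{OT4}(b_1,b_2,t,i)$: $\mathrm{OT}(b_1@i,\ \mathrm{OT}(b_2@i,t.\mathtt{row1},t.\mathtt{row2}),\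 \mathrm{OT}(b_2@i,t.\mathtt{row3},t.\mathtt{row4}))$ - $\mathtt{andgmw}(z,x,y)$: $\mathtt{let}\ r=r[z]\ \mathtt{in}\ \mathtt{let}\ t=\mathtt{andtablegmw}(x,y,r)\ \mathtt{in}\ m[z]@2:=\mathtt{OT4}(x,y,t,2)@1;\ m[z]@1:=r@1;\ m[z]$ - $\mathtt{xorgmw}(z,x,y)$: $m[z]@1:=(x\ \mathtt{xor}\ y)@1;\ m[z]@2:=(x\ \mathtt{xor}\ y)@2;\ m[z]$ - $\mathtt{decodegmw}(z)$: $p[\texttt{"1"}]:=z@1;\ p[\texttt{"2"}]:=z@2;\ \mathsf{out}@1:=(p[\texttt{"1"}]\ \mathtt{xor}\ p[\texttt{"2"}])@1;\ \mathsf{out}@2:=(p[\texttt{"1"}]\ \mathtt{xor}\ p[\texttt{"2"}])@2$ A *circuit* is a let-bound variable, a call $\mathtt{encodegmw}(w,i_1,i_2)$ with $\{i_1,i_2\}=\{1,2\}$, or a call $\mathtt{andgmw}(z,c_1,c_2)$ or $\mathtt{xorgmw}(z,c_1,c_2)$ with circuits $c_1,c_2$, where $w,z$ are identifier strings. A *two-party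 GMW circuit metaprogram* is a sequence of let-bindings of circuits followed by a call $\mathtt{decodegmw}(c)$ on a circuit $c$, in which the identifiers of all encodings and gates are pairwise distinct. **Theorem.** If $e$ is a two-party GMW circuit metaprogram over this library with $(\varnothing,e)\to^*(\pi,())$, then $\pi$ satisfies noninterference modulo output for the federation $\{1,2\}$. -/

import Mathlib

/-! ## Overture: the protocol language over the binary field -/

namespace Overture

/-- The binary field; `xor` is `+`, `and` is `*`, `true` is `1`. -/
abbrev F2 : Type := ZMod 2

/-- Clients are natural numbers. -/
abbrev Client : Type := ℕ

/-- Field expressions `ε`. The expression `ot ε₁ ι ε₂ ε₃` is the (abstract) oblivious transfer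
`OT(ε₁@ι, ε₂, ε₃)`: the receiver `ι` provides the choice bit `ε₁`, and the client that computes the
whole expression (the sender) provides `ε₂` and `ε₃`. -/
inductive FieldExp : Type
  | const (v : F2)
  | secret (w : String)
  | flip (w : String)
  | msg (w : String)
  | pub (w : String)
  | add (ε₁ ε₂ : FieldExp)
  | sub (ε₁ ε₂ : FieldExp)
  | mul (ε₁ ε₂ : FieldExp)
  | ot (ε₁ : FieldExp) (ι : Client) (ε₂ ε₃ : FieldExp)

/-- Program variables: `s[w]@ι`, `r[w]@ι`, `m[w]@ι`, `p[w]`, `out@ι`. -/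
inductive Var : Type
  | secret (w : String) (ι : Client)
  | flip (w : String) (ι : Client)
  | msg (w : String) (ι : Client)
  | pub (w : String)
  | out (ι : Client)
  deriving DecidableEq

/-- Commands: `send w ι₂ ε ι₁` is `m[w]@ι₂ := ε@ι₁` (computed by `ι₁` and sent to `ι₂`),
`reveal w ε ι` is `p[w] := ε@ι`, and `output ε ι` is `out@ι := ε@ι`. -/
inductive Cmd : Type
  | send (w : String) (receiver : Client) (ε : FieldExp) (sender : Client)
  | reveal (w : String) (ε : FieldExp) (ι : Client)
  | output (ε : FieldExp) (ι : Client)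

/-- A protocol `π` is a finite sequence of commands. -/
abbrev Protocol : Type := List Cmd

/-- The variable a command assigns. -/
def Cmd.target : Cmd → Var
  | .send w receiver _ _ => .msg w receiver
  | .reveal w _ _ => .pub w
  | .output _ ι => .out ι

/-- The expression a command computes. -/
def Cmd.expr : Cmd → FieldExp
  | .send _ _ ε _ => ε
  | .reveal _ ε _ => ε
  | .output ε _ => ε

/-- The client that computes the expression of a command. -/
def Cmd.client : Cmd → Client
  | .send _ _ _ sender => sender
  | .reveal _ _ ι => ι
  | .output _ ι => ι

/-! ### Memories -/

/-- Partial maps from variables to field values. Every memory used below has a finite domain. -/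
abbrev Mem : Type := Var → Option F2

/-- The domain of a memory. -/
def Mem.dom (m : Mem) : Set Var := {x | m x ≠ none}

/-- The combination `m ⊎ m'`. -/
def Mem.union (m m' : Mem) : Mem := fun x => (m x).orElse (fun _ => m' x)

/-- The restriction `m_X`. -/
def Mem.restrict (m : Mem) (X : Finset Var) : Mem := fun x => if x ∈ X then m x else none

/-- The extension `m{x ↦ v}`. -/
def Mem.extend (m : Mem) (x : Var) (v : F2) : Mem := Function.update m x (some v)

open Classical in
/-- `mems X`: the finite set of all memories with domain `X`. -/
noncomputable def mems (X : Finset Var) : Finset Mem :=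
  (Finset.univ : Finset (X → F2)).image
    (fun f x => if h : x ∈ X then some (f ⟨x, h⟩) else none)

theorem mem_mems (X : Finset Var) (m : Mem) : m ∈ mems X ↔ m.dom = (X : Set Var) := by
  classical
  simp only [mems, Finset.mem_image, Finset.mem_univ, true_and]
  constructor
  · rintro ⟨f, rfl⟩
    ext x
    by_cases h : x ∈ X <;> simp [Mem.dom, h]
  · intro h
    have hx : ∀ x, m x ≠ none ↔ x ∈ X := fun x => by
      have := Set.ext_iff.mp h x
      simpa [Mem.dom] using this
    refine ⟨fun x => (m x).getD 0, ?_⟩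
    funext x
    by_cases hX : x ∈ X
    · obtain ⟨v, hv⟩ := Option.ne_none_iff_exists'.mp ((hx x).mpr hX)
      simp [hX, hv]
    · have : m x = none := by
        by_contra hne
        exact hX ((hx x).mp hne)
      simp [hX, this]

/-! ### Semantics -/

/-- The value of `ε` computed by client `ι` in memory `m`; undefined if a variable is unset. -/
def FieldExp.eval (m : Mem) : FieldExp → Client → Option F2
  | .const v, _ => some v
  | .secret w, ι => m (.secret w ι)
  | .flip w, ι => m (.flip w ι)
  | .msg w, ι => m (.msg w ι)
  | .pub w, _ => m (.pub w)
  | .add ε₁ ε₂, ι => do return (← ε₁.eval m ι) + (← ε₂.eval m ι)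
  | .sub ε₁ ε₂, ι => do return (← ε₁.eval m ι) - (← ε₂.eval m ι)
  | .mul ε₁ ε₂, ι => do return (← ε₁.eval m ι) * (← ε₂.eval m ι)
  | .ot ε₁ ι₁ ε₂ ε₃, ι => do
      let b ← ε₁.eval m ι₁
      let v₂ ← ε₂.eval m ι
      let v₃ ← ε₃.eval m ι
      return if b = 1 then v₂ else v₃

/-- Small-step reduction: a variable is assigned only if it is not yet defined. -/
inductive Step : Mem × Protocol → Mem × Protocol → Prop
  | assign (m : Mem) (c : Cmd) (π : Protocol) (v : F2)
      (hfresh : m c.target = none) (hval : c.expr.eval m c.client = some v) :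
      Step (m, c :: π) (m.extend c.target v, π)

/-! ### Variables of a protocol -/

/-- The variables used by an expression computed by client `ι`. -/
def FieldExp.vars : FieldExp → Client → Finset Var
  | .const _, _ => ∅
  | .secret w, ι => {.secret w ι}
  | .flip w, ι => {.flip w ι}
  | .msg w, ι => {.msg w ι}
  | .pub w, _ => {.pub w}
  | .add ε₁ ε₂, ι => ε₁.vars ι ∪ ε₂.vars ι
  | .sub ε₁ ε₂, ι => ε₁.vars ι ∪ ε₂.vars ι
  | .mul ε₁ ε₂, ι => ε₁.vars ι ∪ ε₂.vars ι
  | .ot ε₁ ι₁ ε₂ ε₃, ι => ε₁.vars ι₁ ∪ (ε₂.vars ι ∪ ε₃.vars ι)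

/-- All variables occurring in a protocol. -/
def vars : Protocol → Finset Var
  | [] => ∅
  | c :: π => insert c.target (c.expr.vars c.client) ∪ vars π

def Var.isSecret : Var → Bool
  | .secret _ _ => true
  | _ => false

def Var.isFlip : Var → Bool
  | .flip _ _ => true
  | _ => false

def Var.isOut : Var → Bool
  | .out _ => true
  | _ => false

/-- The client owning a variable; public variables have no owner. -/
def Var.owner : Var → Option Client
  | .secret _ ι => some ι
  | .flip _ ι => some ι
  | .msg _ ι => some ι
  | .pub _ => none
  | .out ι => some ι

/-- `S = secrets(π)`. -/
def secrets (π : Protocol) : Finset Var := (vars π).filter (fun x => x.isSecret = true)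

/-- `R = flips(π)`. -/
def flips (π : Protocol) : Finset Var := (vars π).filter (fun x => x.isFlip = true)

/-- The set `O` of output variables of `π`. -/
def outs (π : Protocol) : Finset Var := (vars π).filter (fun x => x.isOut = true)

/-- `iovars(π) = S ∪ M ∪ P ∪ O`. -/
def iovars (π : Protocol) : Finset Var := (vars π).filter (fun x => x.isFlip = false)

open Classical in
/-- `X_I`: the variables in `X` owned by a client in `I`. -/
noncomputable def owned (X : Finset Var) (I : Finset Client) : Finset Var :=
  X.filter (fun x => ∃ ι ∈ I, x.owner = some ι)

open Classical in
/-- The corrupt views `V_{H ▷ C}`: reveals by honest clients, and messages sent by honest clients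
to corrupt clients. -/
noncomputable def corruptViews (π : Protocol) (H C : Finset Client) : Finset Var :=
  (vars π).filter (fun x =>
    (∃ w ε ι, x = .pub w ∧ Cmd.reveal w ε ι ∈ π ∧ ι ∈ H) ∨
    (∃ w ι ε ι', x = .msg w ι ∧ Cmd.send w ι ε ι' ∈ π ∧ ι ∈ C ∧ ι' ∈ H))

/-! ### Distributions -/

/-- Marginal distribution on `X₁ ⊆ X` of `P`, a distribution on `mems X`. -/
noncomputable def marginal (X : Finset Var) (P : Mem → ℝ) (X₁ : Finset Var) (m : Mem) : ℝ :=
  ∑ m' ∈ mems (X \ X₁), P (m.union m')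

open Classical in
/-- Conditional distribution of `X₁` given `X₂` in `P`, a distribution on `mems X`; its argument
ranges over `mems (X₁ ∪ X₂)`. -/
noncomputable def conditional (X : Finset Var) (P : Mem → ℝ) (X₁ X₂ : Finset Var) (m : Mem) : ℝ :=
  if marginal X P X₂ (m.restrict X₂) = 0 then 0
  else marginal X P (X₁ ∪ X₂) m / marginal X P X₂ (m.restrict X₂)

/-- Final memories of the complete runs of `π`, over all random tapes and all input secrets. -/
def runs (π : Protocol) : Set Mem :=
  {m | ∃ m₁ ∈ mems (flips π), ∃ m₂ ∈ mems (secrets π),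
    Relation.ReflTransGen Step (m₁.union m₂, π) (m, [])}

open Classical in
/-- The basic distribution `BD(π)`, on `mems (iovars π ∪ flips π)`. -/
noncomputable def BD (π : Protocol) (m : Mem) : ℝ :=
  if m ∈ runs π then 1 / ((runs π).ncard : ℝ) else 0

/-- Noninterference modulo output for the federation `Fed`: for every partition of `Fed` into honest
and corrupt clients, conditioning additionally on any corrupt views that can occur together with the
given corrupt secrets and outputs does not change the conditional distribution of the honest
secrets. -/
def NoninterferenceModuloOutput (Fed : Finset Client) (π : Protocol) : Prop :=
  ∀ H C : Finset Client, Disjoint H C → H ∪ C = Fed →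
    ∀ m₁ ∈ mems (owned (secrets π) C ∪ outs π), ∀ m₂ ∈ mems (corruptViews π H C),
      0 < marginal (iovars π ∪ flips π) (BD π)
        (owned (secrets π) C ∪ outs π ∪ corruptViews π H C) (m₁.union m₂) →
      ∀ m ∈ mems (owned (secrets π) H),
        conditional (iovars π ∪ flips π) (BD π) (owned (secrets π) H)
            (owned (secrets π) C ∪ outs π) (m.union m₁) =
          conditional (iovars π ∪ flips π) (BD π) (owned (secrets π) H)
            (owned (secrets π) C ∪ outs π ∪ corruptViews π H C) (m.union (m₁.union m₂))

end Overture

/-! ## Prelude: the metalanguage whose residual programs are Overture protocols -/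

namespace Prelude

open Overture

/-- Program variables `y`, function names `f` and record labels are drawn from countable sets. -/
abbrev EVar : Type := ℕ

abbrev FName : Type := ℕ

abbrev Label : Type := ℕ

/-- Values: identifier strings, client ids, field expressions, unit, records. -/
inductive Val : Type
  | str (w : String)
  | client (ι : Client)
  | field (ε : FieldExp)
  | unit
  | record (fs : List (Label × Val))

/-- Syntactic forms that evaluate all their arguments from left to right:
`s[e]`, `r[e]`, `m[e]`, `p[e]`, `e + e`, `e - e`, `e * e`, `e ++ e`, `OT(e@e, e, e)`,
`{ℓ = e; …}`, `e.ℓ`, `m[e]@e := e@e`, `p[e] := e@e`, `out@e := e@e`. -/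
inductive Op : Type
  | secret
  | flip
  | msg
  | pub
  | add
  | sub
  | mul
  | append
  | ot
  | record (ls : List Label)
  | proj (l : Label)
  | send
  | reveal
  | output

/-- Prelude expressions. -/
inductive Exp : Type
  | val (ν : Val)
  | var (y : EVar)
  | op (o : Op) (args : List Exp)
  | call (f : FName) (args : List Exp)
  | letIn (y : EVar) (e₁ e₂ : Exp)
  | seq (e₁ e₂ : Exp)

mutual
/-- The substitution `e[ν/y]`; values contain no program variables. -/
def Exp.subst (y : EVar) (ν : Val) : Exp → Exp
  | .val ν' => .val ν'
  | .var y' => if y' = y then .val ν else .var y'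
  | .op o args => .op o (Exp.substList y ν args)
  | .call f args => .call f (Exp.substList y ν args)
  | .letIn y' e₁ e₂ =>
      .letIn y' (e₁.subst y ν) (if y' = y then e₂ else e₂.subst y ν)
  | .seq e₁ e₂ => .seq (e₁.subst y ν) (e₂.subst y ν)

def Exp.substList (y : EVar) (ν : Val) : List Exp → List Exp
  | [] => []
  | e :: es => e.subst y ν :: Exp.substList y ν es
end

/-- Substitution of several values for distinct variables. -/
def Exp.substAll : Exp → List (EVar × Val) → Exp
  | e, [] => e
  | e, (y, ν) :: σ => (e.subst y ν).substAll σ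

/-- Result of a syntactic form applied to values: the commands added to the residual protocol
(one for a concrete assignment, none otherwise) and the resulting value. -/
def Op.apply : Op → List Val → Option (List Cmd × Val)
  | .secret, [.str w] => some ([], .field (.secret w))
  | .flip, [.str w] => some ([], .field (.flip w))
  | .msg, [.str w] => some ([], .field (.msg w))
  | .pub, [.str w] => some ([], .field (.pub w))
  | .add, [.field ε₁, .field ε₂] => some ([], .field (.add ε₁ ε₂))
  | .sub, [.field ε₁, .field ε₂] => some ([], .field (.sub ε₁ ε₂))
  | .mul, [.field ε₁, .field ε₂] => some ([], .field (.mul ε₁ ε₂))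
  | .append, [.str w₁, .str w₂] => some ([], .str (w₁ ++ w₂))
  | .ot, [.field ε₁, .client ι, .field ε₂, .field ε₃] => some ([], .field (.ot ε₁ ι ε₂ ε₃))
  | .record ls, νs => if ls.length = νs.length then some ([], .record (ls.zip νs)) else none
  | .proj l, [.record fs] => (fs.lookup l).map (fun ν => ([], ν))
  | .send, [.str w, .client ι₂, .field ε, .client ι₁] => some ([.send w ι₂ ε ι₁], .unit)
  | .reveal, [.str w, .field ε, .client ι] => some ([.reveal w ε ι], .unit)
  | .output, [.client ι₂, .field ε, .client ι₁] =>
      if ι₂ = ι₁ then some ([.output ε ι₁], .unit) else none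
  | _, _ => none

/-- A function declaration `f(y₁, …, yₙ) { e }`. -/
structure FnDecl : Type where
  name : FName
  params : List EVar
  body : Exp

abbrev Codebase : Type := List FnDecl

/-- One layer of an evaluation context. -/
inductive Frame : Type
  | op (o : Op) (νs : List Val) (es : List Exp)
  | call (f : FName) (νs : List Val) (es : List Exp)
  | letIn (y : EVar) (e₂ : Exp)
  | seq (e₂ : Exp)

/-- Fill the hole of a frame. -/
def Frame.plug : Frame → Exp → Exp
  | .op o νs es, e => .op o (νs.map .val ++ e :: es)
  | .call f νs es, e => .call f (νs.map .val ++ e :: es)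
  | .letIn y e₂, e => .letIn y e e₂
  | .seq e₂, e => .seq e e₂

/-- Small-step reduction of configurations (residual protocol, expression). An evaluation context
is a composition of frames, so `frame` closes the other rules under evaluation contexts. -/
inductive Step (𝒞 : Codebase) : Protocol × Exp → Protocol × Exp → Prop
  | op (π : Protocol) (o : Op) (νs : List Val) (cs : List Cmd) (ν : Val)
      (h : o.apply νs = some (cs, ν)) :
      Step 𝒞 (π, .op o (νs.map .val)) (π ++ cs, .val ν)
  | call (π : Protocol) (fn : FnDecl) (νs : List Val) (hfn : fn ∈ 𝒞)
      (hlen : fn.params.length = νs.length) :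
      Step 𝒞 (π, .call fn.name (νs.map .val)) (π, fn.body.substAll (fn.params.zip νs))
  | letIn (π : Protocol) (y : EVar) (ν : Val) (e : Exp) :
      Step 𝒞 (π, .letIn y (.val ν) e) (π, e.subst y ν)
  | seq (π : Protocol) (ν : Val) (e : Exp) :
      Step 𝒞 (π, .seq (.val ν) e) (π, e)
  | frame (π π' : Protocol) (F : Frame) (e e' : Exp) (h : Step 𝒞 (π, e) (π', e')) :
      Step 𝒞 (π, F.plug e) (π', F.plug e')

end Prelude

/-! ## The two-party GMW circuit library -/

namespace GMW

open Overture Prelude Prelude.Exp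

abbrev encodegmw : FName := 0
abbrev andtablegmw : FName := 1
abbrev ot4 : FName := 2
abbrev andgmw : FName := 3
abbrev xorgmw : FName := 4
abbrev decodegmw : FName := 5

def str (w : String) : Exp := .val (.str w)
def cl (ι : Client) : Exp := .val (.client ι)
def tt : Exp := .val (.field (.const 1))
def ff : Exp := .val (.field (.const 0))
def xor (a b : Exp) : Exp := .op .add [a, b]
def and (a b : Exp) : Exp := .op .mul [a, b]
/-- `OT(b@i, e₁, e₂)` -/
def ot (b i e₁ e₂ : Exp) : Exp := .op .ot [b, i, e₁, e₂]
def s (e : Exp) : Exp := .op .secret [e]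
def r (e : Exp) : Exp := .op .flip [e]
def m (e : Exp) : Exp := .op .msg [e]
def p (e : Exp) : Exp := .op .pub [e]
def row (e : Exp) (l : Label) : Exp := .op (.proj l) [e]
/-- `m[w]@i₂ := e@i₁` -/
def send (w i₂ e i₁ : Exp) : Exp := .op .send [w, i₂, e, i₁]
/-- `p[w] := e@i` -/
def reveal (w e i : Exp) : Exp := .op .reveal [w, e, i]
/-- `out@i := e@i` -/
def output (i e : Exp) : Exp := .op .output [i, e, i]

/-- The identifier strings consisting of the digit 1, respectively 2. -/
def id1 : String := Nat.repr 1
def id2 : String := Nat.repr 2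

/-- Parameters `in, i1, i2` are the variables `0, 1, 2`:
`m[in]@i2 := (s[in] xor r[in])@i2; m[in]@i1 := r[in]@i2; m[in]`. -/
def encodeDecl : FnDecl where
  name := encodegmw
  params := [0, 1, 2]
  body :=
    .seq (send (var 0) (var 2) (xor (s (var 0)) (r (var 0))) (var 2))
      (.seq (send (var 0) (var 1) (r (var 0)) (var 2))
        (m (var 0)))

/-- Parameters `b1, b2, r` are the variables `0, 1, 2`; `r11, r10, r01, r00` are `3, 4, 5, 6`:
`let r11 = r xor ((b1 xor true) and (b2 xor true)) in …
{ row1 = r11; row2 = r10; row3 = r01; row4 = r00 }`. -/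
def andtableDecl : FnDecl where
  name := andtablegmw
  params := [0, 1, 2]
  body :=
    .letIn 3 (xor (var 2) (and (xor (var 0) tt) (xor (var 1) tt)))
      (.letIn 4 (xor (var 2) (and (xor (var 0) tt) (xor (var 1) ff)))
        (.letIn 5 (xor (var 2) (and (xor (var 0) ff) (xor (var 1) tt)))
          (.letIn 6 (xor (var 2) (and (xor (var 0) ff) (xor (var 1) ff)))
            (.op (.record [1, 2, 3, 4]) [var 3, var 4, var 5, var 6]))))

/-- One-out-of-four oblivious transfer; `b1, b2, table, i` are the variables `0, 1, 2, 3`, and the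
receiver `i` provides the choice bits `b1, b2`. The sender is the client computing the result. -/
def ot4Decl : FnDecl where
  name := ot4
  params := [0, 1, 2, 3]
  body :=
    ot (var 0) (var 3)
      (ot (var 1) (var 3) (row (var 2) 1) (row (var 2) 2))
      (ot (var 1) (var 3) (row (var 2) 3) (row (var 2) 4))

/-- Parameters `z, x, y` are the variables `0, 1, 2`; `r, table` are `3, 4`:
`let r = r[z] in let table = andtablegmw(x, y, r) in
m[z]@2 := OT4(x, y, table, 2)@1; m[z]@1 := r@1; m[z]`. -/
def andDecl : FnDecl where
  name := andgmw
  params := [0, 1, 2]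
  body :=
    .letIn 3 (r (var 0))
      (.letIn 4 (.call andtablegmw [var 1, var 2, var 3])
        (.seq (send (var 0) (cl 2) (.call ot4 [var 1, var 2, var 4, cl 2]) (cl 1))
          (.seq (send (var 0) (cl 1) (var 3) (cl 1))
            (m (var 0)))))

/-- Parameters `z, x, y` are the variables `0, 1, 2`:
`m[z]@1 := (x xor y)@1; m[z]@2 := (x xor y)@2; m[z]`. -/
def xorDecl : FnDecl where
  name := xorgmw
  params := [0, 1, 2]
  body :=
    .seq (send (var 0) (cl 1) (xor (var 1) (var 2)) (cl 1))
      (.seq (send (var 0) (cl 2) (xor (var 1) (var 2)) (cl 2))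
        (m (var 0)))

/-- The parameter `z` is the variable `0`. Both clients reveal their shares and output the sum. -/
def decodeDecl : FnDecl where
  name := decodegmw
  params := [0]
  body :=
    .seq (reveal (str id1) (var 0) (cl 1))
      (.seq (reveal (str id2) (var 0) (cl 2))
        (.seq (output (cl 1) (xor (p (str id1)) (p (str id2))))
          (output (cl 2) (xor (p (str id1)) (p (str id2))))))

/-- The GMW library. -/
def library : Codebase := [encodeDecl, andtableDecl, ot4Decl, andDecl, xorDecl, decodeDecl]

/-- `IsCircuit e ws`: `e` is built from let-bound variables, encodings of secrets of one of the two
clients, and gates; `ws` lists the identifiers of its encodings and gates. -/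
inductive IsCircuit : Exp → List String → Prop
  | var (y : EVar) : IsCircuit (.var y) []
  | encode (w : String) (i₁ i₂ : Client) (h : (i₁ = 1 ∧ i₂ = 2) ∨ (i₁ = 2 ∧ i₂ = 1)) :
      IsCircuit (.call encodegmw [str w, cl i₁, cl i₂]) [w]
  | and (z : String) (e₁ e₂ : Exp) (ws₁ ws₂ : List String)
      (h₁ : IsCircuit e₁ ws₁) (h₂ : IsCircuit e₂ ws₂) :
      IsCircuit (.call andgmw [str z, e₁, e₂]) (z :: (ws₁ ++ ws₂))
  | xor (z : String) (e₁ e₂ : Exp) (ws₁ ws₂ : List String)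
      (h₁ : IsCircuit e₁ ws₁) (h₂ : IsCircuit e₂ ws₂) :
      IsCircuit (.call xorgmw [str z, e₁, e₂]) (z :: (ws₁ ++ ws₂))

/-- A sequence of let-bindings followed by a call to `decodegmw` on a circuit. -/
inductive IsProgram : Exp → List String → Prop
  | decode (e : Exp) (ws : List String) (h : IsCircuit e ws) :
      IsProgram (.call decodegmw [e]) ws
  | letIn (y : EVar) (e₁ e₂ : Exp) (ws₁ ws₂ : List String)
      (h₁ : IsCircuit e₁ ws₁) (h₂ : IsProgram e₂ ws₂) :
      IsProgram (.letIn y e₁ e₂) (ws₁ ++ ws₂)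

/-- Two-party GMW circuit metaprograms, with unique identifiers. -/
def IsGMWCircuit (e : Exp) : Prop := ∃ ws : List String, IsProgram e ws ∧ ws.Nodup

end GMW

-- The metaprogram leaves behind a straight-line circuit: a list of encodings and gates with
-- distinct identifiers, each reading earlier wires only, followed by the decoding
-- (`IsGMWCircuit.compile`). Every command of such a protocol assigns a fresh variable from defined
-- ones, so a run is the same as a solution of the equations "target = expression", and the secrets
-- and random bits can be chosen freely (`Executable.mem_runs`).
--
-- Every wire is additively shared. The sum of its two shares is the plaintext value, which depends
-- on the secrets alone (`plain_eq`). An encoding or an `and` gate has a random bit of its own, and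
-- either share of it differs from this bit by a quantity that depends on the secrets alone
-- (`mask_eq`); the shares of an `xor` gate are sums of earlier shares of the same client. Hence,
-- for fixed secrets, the random tapes correspond bijectively to the shares of one client `j` at the
-- masked gates. Two consequences carry the argument: a run can be given the secrets of any other
-- run without changing the shares of `j` (`exists_resampling`), and the secrets together with the
-- shares of `j` determine the run (`solution_unique`).
--
-- Let `j` be the corrupt client. The messages in its view are shares of `j`. The two public bits
-- are the shares of the output wire; one belongs to `j`, and the other is its sum with the output
-- (`pub_eq`). So the corrupt view is a function of the outputs and the shares of `j`. Among the
-- runs with given corrupt secrets and outputs, resampling therefore matches the runs over one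
-- achievable value of the honest secrets with those over another, and preserves the view. All
-- fibers have equal size, also after intersection with the event that fixes the view, and this is
-- the independence of honest secrets and corrupt view (`card_mul_card_of_fibers`,
-- `conditional_eq_of_resampling`).

namespace Prelude

open Overture

-- Big-step evaluation of the metalanguage

mutual
/-- Big-step evaluation: `e` evaluates to `ν`, emitting the commands `cs`. -/
inductive Big (𝒞 : Codebase) : Exp → List Cmd → Val → Prop
  | val (ν : Val) : Big 𝒞 (.val ν) [] ν
  | op (o : Op) (args : List Exp) (cs cs' : List Cmd) (νs : List Val) (ν : Val)
      (hargs : BigList 𝒞 args cs νs) (h : o.apply νs = some (cs', ν)) :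
      Big 𝒞 (.op o args) (cs ++ cs') ν
  | call (fn : FnDecl) (args : List Exp) (cs cs' : List Cmd) (νs : List Val) (ν : Val)
      (hargs : BigList 𝒞 args cs νs) (hfn : fn ∈ 𝒞) (hlen : fn.params.length = νs.length)
      (h : Big 𝒞 (fn.body.substAll (fn.params.zip νs)) cs' ν) :
      Big 𝒞 (.call fn.name args) (cs ++ cs') ν
  | letIn (y : EVar) (e₁ e₂ : Exp) (cs cs' : List Cmd) (ν₁ ν : Val)
      (h₁ : Big 𝒞 e₁ cs ν₁) (h₂ : Big 𝒞 (e₂.subst y ν₁) cs' ν) :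
      Big 𝒞 (.letIn y e₁ e₂) (cs ++ cs') ν
  | seq (e₁ e₂ : Exp) (cs cs' : List Cmd) (ν₁ ν : Val)
      (h₁ : Big 𝒞 e₁ cs ν₁) (h₂ : Big 𝒞 e₂ cs' ν) :
      Big 𝒞 (.seq e₁ e₂) (cs ++ cs') ν

/-- Left-to-right big-step evaluation of a list of arguments. -/
inductive BigList (𝒞 : Codebase) : List Exp → List Cmd → List Val → Prop
  | nil : BigList 𝒞 [] [] []
  | cons (e : Exp) (es : List Exp) (cs cs' : List Cmd) (ν : Val) (νs : List Val)
      (h : Big 𝒞 e cs ν) (hs : BigList 𝒞 es cs' νs) :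
      BigList 𝒞 (e :: es) (cs ++ cs') (ν :: νs)
end

variable {𝒞 : Codebase}

theorem big_val_iff {ν ν' : Val} {cs : List Cmd} :
    Big 𝒞 (.val ν) cs ν' ↔ cs = [] ∧ ν' = ν := by
  constructor
  · rintro ⟨⟩
    exact ⟨rfl, rfl⟩
  · rintro ⟨rfl, rfl⟩
    exact .val _

theorem not_big_var {y : EVar} {cs : List Cmd} {ν : Val} : ¬ Big 𝒞 (.var y) cs ν := by
  rintro ⟨⟩

theorem big_op_iff {o : Op} {args : List Exp} {cs : List Cmd} {ν : Val} :
    Big 𝒞 (.op o args) cs ν ↔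
      ∃ cs₁ νs, BigList 𝒞 args cs₁ νs ∧ ∃ cs₂, o.apply νs = some (cs₂, ν) ∧ cs = cs₁ ++ cs₂ := by
  constructor
  · rintro ⟨⟩
    exact ⟨_, _, ‹_›, _, ‹_›, rfl⟩
  · rintro ⟨cs₁, νs, h, cs₂, h', rfl⟩
    exact .op _ _ _ _ _ _ h h'

theorem big_call_iff {f : FName} {args : List Exp} {cs : List Cmd} {ν : Val} :
    Big 𝒞 (.call f args) cs ν ↔
      ∃ cs₁ νs, BigList 𝒞 args cs₁ νs ∧ ∃ fn ∈ 𝒞, fn.name = f ∧ fn.params.length = νs.length ∧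
        ∃ cs₂, Big 𝒞 (fn.body.substAll (fn.params.zip νs)) cs₂ ν ∧ cs = cs₁ ++ cs₂ := by
  constructor
  · rintro ⟨⟩
    exact ⟨_, _, ‹_›, _, ‹_›, rfl, ‹_›, _, ‹_›, rfl⟩
  · rintro ⟨cs₁, νs, h, fn, hfn, rfl, hlen, cs₂, h', rfl⟩
    exact .call _ _ _ _ _ _ h hfn hlen h'

theorem big_letIn_iff {y : EVar} {e₁ e₂ : Exp} {cs : List Cmd} {ν : Val} :
    Big 𝒞 (.letIn y e₁ e₂) cs ν ↔
      ∃ cs₁ ν₁, Big 𝒞 e₁ cs₁ ν₁ ∧ ∃ cs₂, Big 𝒞 (e₂.subst y ν₁) cs₂ ν ∧ cs = cs₁ ++ cs₂ := by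
  constructor
  · rintro ⟨⟩
    exact ⟨_, _, ‹_›, _, ‹_›, rfl⟩
  · rintro ⟨cs₁, νs, h, cs₂, h', rfl⟩
    exact .letIn _ _ _ _ _ _ _ h h'

theorem big_seq_iff {e₁ e₂ : Exp} {cs : List Cmd} {ν : Val} :
    Big 𝒞 (.seq e₁ e₂) cs ν ↔
      ∃ cs₁ ν₁, Big 𝒞 e₁ cs₁ ν₁ ∧ ∃ cs₂, Big 𝒞 e₂ cs₂ ν ∧ cs = cs₁ ++ cs₂ := by
  constructor
  · intro h
    cases h with
    | seq _ _ _ _ _ _ h₁ h₂ => exact ⟨_, _, h₁, _, h₂, rfl⟩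
  · rintro ⟨cs₁, νs, h, cs₂, h', rfl⟩
    exact .seq _ _ _ _ _ _ h h'

theorem bigList_nil_iff {cs : List Cmd} {νs : List Val} :
    BigList 𝒞 [] cs νs ↔ cs = [] ∧ νs = [] := by
  constructor
  · rintro ⟨⟩
    exact ⟨rfl, rfl⟩
  · rintro ⟨rfl, rfl⟩
    exact .nil

theorem bigList_cons_iff {e : Exp} {es : List Exp} {cs : List Cmd} {νs : List Val} :
    BigList 𝒞 (e :: es) cs νs ↔
      ∃ cs₁ ν, Big 𝒞 e cs₁ ν ∧ ∃ cs₂ νs', BigList 𝒞 es cs₂ νs' ∧ νs = ν :: νs' ∧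
        cs = cs₁ ++ cs₂ := by
  constructor
  · intro h
    cases h with
    | cons _ _ _ _ _ _ h₁ h₂ => exact ⟨_, _, h₁, _, _, h₂, rfl, rfl⟩
  · rintro ⟨cs₁, ν, h, cs₂, νs', h', rfl, rfl⟩
    exact .cons _ _ _ _ _ _ h h'

theorem bigList_vals (νs : List Val) : BigList 𝒞 (νs.map .val) [] νs := by
  induction νs with
  | nil => exact .nil
  | cons ν νs ih => exact .cons _ _ [] [] _ _ (.val ν) ih

/-- The arguments left of the hole are values and emit nothing, so the commands `cs₀` of a step in
the hole come before all others. -/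
theorem bigList_hole {e e' : Exp} {cs₀ : List Cmd}
    (h : ∀ cs ν, Big 𝒞 e' cs ν → Big 𝒞 e (cs₀ ++ cs) ν) (νs : List Val) (es : List Exp) :
    ∀ cs νs', BigList 𝒞 (νs.map .val ++ e' :: es) cs νs' →
      BigList 𝒞 (νs.map .val ++ e :: es) (cs₀ ++ cs) νs' := by
  induction νs with
  | nil =>
    simp only [List.map_nil, List.nil_append, bigList_cons_iff]
    rintro _ _ ⟨cs₁, ν, he, cs₂, νs', hs, rfl, rfl⟩
    exact ⟨_, ν, h _ _ he, cs₂, νs', hs, rfl, by simp⟩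
  | cons ν νs ih =>
    simp only [List.map_cons, List.cons_append, bigList_cons_iff, big_val_iff]
    rintro _ _ ⟨_, _, ⟨rfl, rfl⟩, cs₂, νs', hs, rfl, rfl⟩
    exact ⟨[], _, ⟨rfl, rfl⟩, _, νs', ih _ _ hs, rfl, by simp⟩

/-- Big-step evaluation is closed under head expansion. -/
theorem Step.big {a b : Protocol × Exp} (h : Step 𝒞 a b) :
    ∃ cs₀, b.1 = a.1 ++ cs₀ ∧ ∀ cs ν, Big 𝒞 b.2 cs ν → Big 𝒞 a.2 (cs₀ ++ cs) ν := by
  induction h with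
  | op π o νs cs ν h =>
    refine ⟨cs, rfl, fun cs' ν' h' => ?_⟩
    obtain ⟨rfl, rfl⟩ := big_val_iff.mp h'
    exact big_op_iff.mpr ⟨[], νs, bigList_vals νs, cs, h, by simp⟩
  | call π fn νs hfn hlen =>
    refine ⟨[], by simp, fun cs' ν' h' => ?_⟩
    exact .call _ _ [] _ _ _ (bigList_vals νs) hfn hlen h'
  | letIn π y ν e => exact ⟨[], by simp, fun cs' ν' h' => .letIn _ _ _ [] _ _ _ (.val ν) h'⟩
  | seq π ν e => exact ⟨[], by simp, fun cs' ν' h' => .seq _ _ [] _ _ _ (.val ν) h'⟩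
  | frame π π' F e e' h ih =>
    obtain ⟨cs₀, h₁, h₂⟩ := ih
    refine ⟨cs₀, h₁, fun cs ν h' => ?_⟩
    dsimp only at h₂ h' ⊢
    cases F with
    | op o νs es =>
      obtain ⟨cs₁, νs', hl, cs₂, ha, rfl⟩ := big_op_iff.mp h'
      exact big_op_iff.mpr ⟨_, νs', bigList_hole h₂ _ _ _ _ hl, cs₂, ha, by simp⟩
    | call f νs es =>
      obtain ⟨cs₁, νs', hl, fn, hfn, hn, hlen, cs₂, hb, rfl⟩ := big_call_iff.mp h'
      exact big_call_iff.mpr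
        ⟨_, νs', bigList_hole h₂ _ _ _ _ hl, fn, hfn, hn, hlen, cs₂, hb, by simp⟩
    | letIn y e₂ =>
      obtain ⟨cs₁, ν₁, hb, cs₂, hb', rfl⟩ := big_letIn_iff.mp h'
      exact big_letIn_iff.mpr ⟨_, ν₁, h₂ _ _ hb, cs₂, hb', by simp⟩
    | seq e₂ =>
      obtain ⟨cs₁, ν₁, hb, cs₂, hb', rfl⟩ := big_seq_iff.mp h'
      exact big_seq_iff.mpr ⟨_, ν₁, h₂ _ _ hb, cs₂, hb', by simp⟩

/-- Backward induction from the final value by head expansion. The start configuration is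
generalized to an arbitrary residual protocol, to which reduction only appends. -/
theorem big_of_steps {π : Protocol} {e : Exp} {ν : Val}
    (h : Relation.ReflTransGen (Step 𝒞) ([], e) (π, .val ν)) : Big 𝒞 e π ν := by
  have key : ∀ a : Protocol × Exp, Relation.ReflTransGen (Step 𝒞) a (π, .val ν) →
      ∃ cs, π = a.1 ++ cs ∧ Big 𝒞 a.2 cs ν := by
    intro a ha
    induction ha using Relation.ReflTransGen.head_induction_on with
    | refl => exact ⟨[], by simp, .val ν⟩
    | head hab _ ih =>
      obtain ⟨cs, hcs, hb⟩ := ih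
      obtain ⟨cs₀, h₁, h₂⟩ := hab.big
      exact ⟨cs₀ ++ cs, by rw [hcs, h₁, List.append_assoc], h₂ _ _ hb⟩
  obtain ⟨cs, hcs, hb⟩ := key _ h
  simpa [hcs] using hb

end Prelude

-- Straight-line circuits and partially evaluated metaprograms

namespace GMW

open Overture Prelude

/-- Gates of a straight-line circuit: encodings of a secret of client `i₂`, and the two logical
gates, whose inputs are named by the identifiers of earlier gates. -/
inductive Gate : Type
  | enc (w : String) (i₁ i₂ : Client)
  | and (z a b : String)
  | xor (z a b : String)

def Gate.name : Gate → String
  | .enc w _ _ => w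
  | .and z _ _ => z
  | .xor z _ _ => z

def Gate.refs : Gate → List String
  | .enc _ _ _ => []
  | .and _ a b => [a, b]
  | .xor _ a b => [a, b]

def Gate.Valid : Gate → Prop
  | .enc _ i₁ i₂ => (i₁ = 1 ∧ i₂ = 2) ∨ (i₁ = 2 ∧ i₂ = 1)
  | .and _ _ _ => True
  | .xor _ _ _ => True

/-- A row of the table of an `and` gate. -/
def tableRow (z a b : String) (c₁ c₂ : F2) : FieldExp :=
  .add (.flip z) (.mul (.add (.msg a) (.const c₁)) (.add (.msg b) (.const c₂)))

def Gate.cmds : Gate → Protocol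
  | .enc w i₁ i₂ => [.send w i₂ (.add (.secret w) (.flip w)) i₂, .send w i₁ (.flip w) i₂]
  | .and z a b =>
      [.send z 2 (.ot (.msg a) 2 (.ot (.msg b) 2 (tableRow z a b 1 1) (tableRow z a b 1 0))
        (.ot (.msg b) 2 (tableRow z a b 0 1) (tableRow z a b 0 0))) 1,
      .send z 1 (.flip z) 1]
  | .xor z a b =>
      [.send z 1 (.add (.msg a) (.msg b)) 1, .send z 2 (.add (.msg a) (.msg b)) 2]

def decodeCmds (c : String) : Protocol :=
  [.reveal id1 (.msg c) 1, .reveal id2 (.msg c) 2,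
    .output (.add (.pub id1) (.pub id2)) 1, .output (.add (.pub id1) (.pub id2)) 2]

/-- The protocol of a straight-line circuit with output wire `c`. -/
def circuitProtocol (gs : List Gate) (c : String) : Protocol :=
  gs.flatMap Gate.cmds ++ decodeCmds c

/-- Every gate of `gs` is valid and refers to `K` and to earlier gates only. -/
def Wired : Set String → List Gate → Prop
  | _, [] => True
  | K, g :: gs => g.Valid ∧ (∀ a ∈ g.refs, a ∈ K) ∧ Wired (insert g.name K) gs

theorem Wired.append {K : Set String} {gs gs' : List Gate} (h : Wired K gs)
    (h' : Wired (K ∪ {w | w ∈ gs.map Gate.name}) gs') : Wired K (gs ++ gs') := by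
  induction gs generalizing K with
  | nil => simpa using h'
  | cons g gs ih =>
    refine ⟨h.1, h.2.1, ih h.2.2 ?_⟩
    convert h' using 1
    ext w
    simp [or_left_comm, or_assoc]

theorem Wired.mono {K K' : Set String} (hK : K ⊆ K') {gs : List Gate} (h : Wired K gs) :
    Wired K' gs := by
  induction gs generalizing K K' with
  | nil => trivial
  | cons g gs ih =>
    exact ⟨h.1, fun a ha => hK (h.2.1 a ha), ih (Set.insert_subset_insert hK) h.2.2⟩

/-- Circuits in which some variables were replaced by wires from `K`. -/
inductive IsWireCircuit (K : Set String) : Exp → List String → Prop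
  | var (y : EVar) : IsWireCircuit K (.var y) []
  | wire (w : String) (h : w ∈ K) : IsWireCircuit K (.val (.field (.msg w))) []
  | encode (w : String) (i₁ i₂ : Client) (h : (i₁ = 1 ∧ i₂ = 2) ∨ (i₁ = 2 ∧ i₂ = 1)) :
      IsWireCircuit K (.call encodegmw [str w, cl i₁, cl i₂]) [w]
  | and (z : String) (e₁ e₂ : Exp) (ws₁ ws₂ : List String)
      (h₁ : IsWireCircuit K e₁ ws₁) (h₂ : IsWireCircuit K e₂ ws₂) :
      IsWireCircuit K (.call andgmw [str z, e₁, e₂]) (z :: (ws₁ ++ ws₂))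
  | xor (z : String) (e₁ e₂ : Exp) (ws₁ ws₂ : List String)
      (h₁ : IsWireCircuit K e₁ ws₁) (h₂ : IsWireCircuit K e₂ ws₂) :
      IsWireCircuit K (.call xorgmw [str z, e₁, e₂]) (z :: (ws₁ ++ ws₂))

/-- Programs with `n` let-bindings in which some variables were replaced by wires from `K`. -/
inductive IsWireProgram (K : Set String) : ℕ → Exp → List String → Prop
  | decode (e : Exp) (ws : List String) (h : IsWireCircuit K e ws) :
      IsWireProgram K 0 (.call decodegmw [e]) ws
  | letIn (n : ℕ) (y : EVar) (e₁ e₂ : Exp) (ws₁ ws₂ : List String)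
      (h₁ : IsWireCircuit K e₁ ws₁) (h₂ : IsWireProgram K n e₂ ws₂) :
      IsWireProgram K (n + 1) (.letIn y e₁ e₂) (ws₁ ++ ws₂)

theorem IsCircuit.isWireCircuit {e : Exp} {ws : List String} (h : IsCircuit e ws)
    (K : Set String) : IsWireCircuit K e ws := by
  induction h with
  | var y => exact .var y
  | encode w i₁ i₂ h => exact .encode w i₁ i₂ h
  | and z e₁ e₂ ws₁ ws₂ _ _ ih₁ ih₂ => exact .and _ _ _ _ _ ih₁ ih₂
  | xor z e₁ e₂ ws₁ ws₂ _ _ ih₁ ih₂ => exact .xor _ _ _ _ _ ih₁ ih₂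

theorem IsProgram.isWireProgram {e : Exp} {ws : List String} (h : IsProgram e ws)
    (K : Set String) : ∃ n, IsWireProgram K n e ws := by
  induction h with
  | decode e ws h => exact ⟨0, .decode e ws (h.isWireCircuit K)⟩
  | letIn y e₁ e₂ ws₁ ws₂ h₁ _ ih =>
    obtain ⟨n, ih⟩ := ih
    exact ⟨n + 1, .letIn _ _ _ _ _ _ (h₁.isWireCircuit K) ih⟩

theorem IsWireCircuit.mono {K K' : Set String} (hK : K ⊆ K') {e : Exp} {ws : List String}
    (h : IsWireCircuit K e ws) : IsWireCircuit K' e ws := by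
  induction h with
  | var y => exact .var y
  | wire w h => exact .wire w (hK h)
  | encode w i₁ i₂ h => exact .encode w i₁ i₂ h
  | and z e₁ e₂ ws₁ ws₂ _ _ ih₁ ih₂ => exact .and _ _ _ _ _ ih₁ ih₂
  | xor z e₁ e₂ ws₁ ws₂ _ _ ih₁ ih₂ => exact .xor _ _ _ _ _ ih₁ ih₂

theorem IsWireProgram.mono {K K' : Set String} (hK : K ⊆ K') {n : ℕ} {e : Exp}
    {ws : List String} (h : IsWireProgram K n e ws) : IsWireProgram K' n e ws := by
  induction h with
  | decode e ws h => exact .decode e ws (h.mono hK)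
  | letIn n y e₁ e₂ ws₁ ws₂ h₁ _ ih => exact .letIn _ _ _ _ _ _ (h₁.mono hK) ih

/-- Evaluation is call-by-value and circuits evaluate to wires, so a `let` only ever substitutes an
expression `m[w]`; the syntactic class is closed under this. -/
theorem IsWireCircuit.subst {K : Set String} {e : Exp} {ws : List String}
    (h : IsWireCircuit K e ws) (y : EVar) {w : String} (hw : w ∈ K) :
    IsWireCircuit K (e.subst y (.field (.msg w))) ws := by
  induction h with
  | var y' =>
    simp only [Exp.subst]
    split_ifs
    · exact .wire w hw
    · exact .var y'
  | wire w h => exact .wire w h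
  | encode w i₁ i₂ h => exact .encode w i₁ i₂ h
  | and z e₁ e₂ ws₁ ws₂ _ _ ih₁ ih₂ => exact .and _ _ _ _ _ ih₁ ih₂
  | xor z e₁ e₂ ws₁ ws₂ _ _ ih₁ ih₂ => exact .xor _ _ _ _ _ ih₁ ih₂

theorem IsWireProgram.subst {K : Set String} {n : ℕ} {e : Exp} {ws : List String}
    (h : IsWireProgram K n e ws) (y : EVar) {w : String} (hw : w ∈ K) :
    IsWireProgram K n (e.subst y (.field (.msg w))) ws := by
  induction h with
  | decode e ws h => exact .decode _ ws (h.subst y hw)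
  | letIn n y' e₁ e₂ ws₁ ws₂ h₁ h₂ ih =>
    simp only [Exp.subst]
    split_ifs
    · exact .letIn _ _ _ _ _ _ (h₁.subst y hw) h₂
    · exact .letIn _ _ _ _ _ _ (h₁.subst y hw) ih

-- Compilation of metaprograms to gate lists

/-- The semantics lets a call pick any declaration of the right name; the names in the library are
distinct, so the choice is forced. -/
theorem big_library_call_iff {fn : FnDecl} (hfn : fn ∈ library) {args : List Exp}
    {cs : List Cmd} {ν : Val} :
    Big library (.call fn.name args) cs ν ↔
      ∃ cs₁ νs, BigList library args cs₁ νs ∧ fn.params.length = νs.length ∧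
        ∃ cs₂, Big library (fn.body.substAll (fn.params.zip νs)) cs₂ ν ∧ cs = cs₁ ++ cs₂ := by
  have huniq : ∀ fn' ∈ library, fn'.name = fn.name → fn' = fn := by
    intro fn' hfn' hname
    simp only [library, List.mem_cons, List.not_mem_nil, or_false] at hfn hfn'
    rcases hfn with rfl | rfl | rfl | rfl | rfl | rfl <;>
      rcases hfn' with rfl | rfl | rfl | rfl | rfl | rfl <;> first | rfl | cases hname
  rw [big_call_iff]
  constructor
  · rintro ⟨cs₁, νs, hl, fn', hfn', hname, h⟩
    cases huniq fn' hfn' hname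
    exact ⟨cs₁, νs, hl, h⟩
  · rintro ⟨cs₁, νs, hl, h⟩
    exact ⟨cs₁, νs, hl, fn, hfn, rfl, h⟩

/-- An equivalence, so that it can act as a rewriting rule under the existential quantifiers in
`big_and_body`. -/
theorem big_andtable_iff {ε₁ ε₂ ε₃ : FieldExp} {cs : List Cmd} {ν : Val} :
    Big library (.call andtablegmw
        [.val (.field ε₁), .val (.field ε₂), .val (.field ε₃)]) cs ν ↔
      cs = [] ∧ ν = .record
        [(1, .field (.add ε₃ (.mul (.add ε₁ (.const 1)) (.add ε₂ (.const 1))))),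
          (2, .field (.add ε₃ (.mul (.add ε₁ (.const 1)) (.add ε₂ (.const 0))))),
          (3, .field (.add ε₃ (.mul (.add ε₁ (.const 0)) (.add ε₂ (.const 1))))),
          (4, .field (.add ε₃ (.mul (.add ε₁ (.const 0)) (.add ε₂ (.const 0)))))] := by
  rw [show andtablegmw = andtableDecl.name from rfl,
    big_library_call_iff (fn := andtableDecl) (by simp [library])]
  simp only [bigList_cons_iff, bigList_nil_iff, big_val_iff]
  constructor
  · rintro ⟨_, _, ⟨_, _, ⟨rfl, rfl⟩, _, _, ⟨_, _, ⟨rfl, rfl⟩, _, _, ⟨_, _, ⟨rfl, rfl⟩, _, _,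
      ⟨rfl, rfl⟩, rfl, rfl⟩, rfl, rfl⟩, rfl, rfl⟩, -, cs₂, hb, rfl⟩
    simp [andtableDecl, Exp.substAll, Exp.subst, Exp.substList, GMW.xor, GMW.and, tt, ff,
      big_letIn_iff, big_op_iff, bigList_cons_iff, bigList_nil_iff, big_val_iff, Op.apply] at hb
    simp [hb]
  · rintro ⟨rfl, rfl⟩
    refine ⟨_, _, ⟨_, _, ⟨rfl, rfl⟩, _, _, ⟨_, _, ⟨rfl, rfl⟩, _, _, ⟨_, _, ⟨rfl, rfl⟩, _, _,
      ⟨rfl, rfl⟩, rfl, rfl⟩, rfl, rfl⟩, rfl, rfl⟩, rfl, [], ?_, rfl⟩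
    simp [andtableDecl, Exp.substAll, Exp.subst, Exp.substList, GMW.xor, GMW.and, tt, ff,
      big_letIn_iff, big_op_iff, bigList_cons_iff, bigList_nil_iff, big_val_iff, Op.apply]

theorem big_ot4_eval {ε₁ ε₂ t₁ t₂ t₃ t₄ : FieldExp} {ι : Client} {cs : List Cmd} {ν : Val}
    (h : Big library (.call ot4 [.val (.field ε₁), .val (.field ε₂),
      .val (.record [(1, .field t₁), (2, .field t₂), (3, .field t₃), (4, .field t₄)]),
      .val (.client ι)]) cs ν) :
      cs = [] ∧ ν = .field (.ot ε₁ ι (.ot ε₂ ι t₁ t₂) (.ot ε₂ ι t₃ t₄)) := by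
  rw [show ot4 = ot4Decl.name from rfl,
    big_library_call_iff (fn := ot4Decl) (by simp [library])] at h
  simp only [bigList_cons_iff, bigList_nil_iff, big_val_iff] at h
  obtain ⟨_, _, ⟨_, _, ⟨rfl, rfl⟩, _, _, ⟨_, _, ⟨rfl, rfl⟩, _, _, ⟨_, _, ⟨rfl, rfl⟩, _, _,
    ⟨_, _, ⟨rfl, rfl⟩, _, _, ⟨rfl, rfl⟩, rfl, rfl⟩, rfl, rfl⟩, rfl, rfl⟩, rfl, rfl⟩,
    -, cs₂, hb, rfl⟩ := h
  simp [ot4Decl, Exp.substAll, Exp.subst, Exp.substList, ot, row,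
    big_op_iff, bigList_cons_iff, bigList_nil_iff, big_val_iff, Op.apply, List.lookup] at hb
  simp [hb]

theorem big_encode {w : String} {i₁ i₂ : Client} {cs : List Cmd} {ν : Val}
    (h : Big library (.call encodegmw [str w, cl i₁, cl i₂]) cs ν) :
    cs = (Gate.enc w i₁ i₂).cmds ∧ ν = .field (.msg w) := by
  rw [show encodegmw = encodeDecl.name from rfl,
    big_library_call_iff (fn := encodeDecl) (by simp [library])] at h
  simp only [bigList_cons_iff, bigList_nil_iff, big_val_iff, str, cl] at h
  obtain ⟨_, _, ⟨_, _, ⟨rfl, rfl⟩, _, _, ⟨_, _, ⟨rfl, rfl⟩, _, _, ⟨_, _, ⟨rfl, rfl⟩, _, _,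
    ⟨rfl, rfl⟩, rfl, rfl⟩, rfl, rfl⟩, rfl, rfl⟩, -, cs₂, hb, rfl⟩ := h
  simp [encodeDecl, Exp.substAll, Exp.subst, Exp.substList, send, GMW.xor, s, r, m, big_seq_iff,
    big_op_iff, bigList_cons_iff, bigList_nil_iff, big_val_iff, Op.apply] at hb
  simp [hb, Gate.cmds]

theorem big_gate_call {fn : FnDecl} (hfn : fn ∈ library) {z : String} {e₁ e₂ : Exp}
    {cs : List Cmd} {ν : Val} (h : Big library (.call fn.name [str z, e₁, e₂]) cs ν) :
    ∃ cs₁ ν₁ cs₂ ν₂ cs₃, Big library e₁ cs₁ ν₁ ∧ Big library e₂ cs₂ ν₂ ∧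
      cs = cs₁ ++ cs₂ ++ cs₃ ∧
        Big library (fn.body.substAll (fn.params.zip [.str z, ν₁, ν₂])) cs₃ ν := by
  obtain ⟨_, νs, hl, hlen, cs₃, hb, rfl⟩ := (big_library_call_iff hfn).mp h
  simp only [bigList_cons_iff, bigList_nil_iff, big_val_iff, str] at hl
  obtain ⟨_, _, ⟨rfl, rfl⟩, _, _, ⟨cs₁, ν₁, h₁, _, _, ⟨cs₂, ν₂, h₂, _, _, ⟨rfl, rfl⟩, rfl, rfl⟩,
    rfl, rfl⟩, rfl, rfl⟩ := hl
  exact ⟨cs₁, ν₁, cs₂, ν₂, cs₃, h₁, h₂, by simp, hb⟩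

theorem big_xor_body {z a b : String} {cs : List Cmd} {ν : Val}
    (h : Big library (xorDecl.body.substAll
      (xorDecl.params.zip [.str z, .field (.msg a), .field (.msg b)])) cs ν) :
    cs = (Gate.xor z a b).cmds ∧ ν = .field (.msg z) := by
  simp [xorDecl, Exp.substAll, Exp.subst, Exp.substList, send, GMW.xor, m, cl, big_seq_iff,
    big_op_iff, bigList_cons_iff, bigList_nil_iff, big_val_iff, Op.apply] at h
  simp [h, Gate.cmds]

theorem big_and_body {z a b : String} {cs : List Cmd} {ν : Val}
    (h : Big library (andDecl.body.substAll
      (andDecl.params.zip [.str z, .field (.msg a), .field (.msg b)])) cs ν) :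
    cs = (Gate.and z a b).cmds ∧ ν = .field (.msg z) := by
  simp [andDecl, Exp.substAll, Exp.subst, Exp.substList, send, r, m, cl, big_letIn_iff,
    big_andtable_iff, big_seq_iff,
    big_op_iff, bigList_cons_iff, bigList_nil_iff, big_val_iff, Op.apply] at h
  obtain ⟨ν₀, cs₁, ν₁, cs₂, ⟨⟨hot, hsend⟩, rfl⟩, rfl⟩ := h
  obtain ⟨rfl, rfl⟩ := big_ot4_eval hot
  simp only [Option.some.injEq, Prod.mk.injEq] at hsend
  simp [← hsend.1, Gate.cmds, tableRow]

/-- That the argument evaluates to a wire comes from `IsWireCircuit.compile` only, so the emitted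
commands are described under this condition. -/
theorem big_decode {e : Exp} {cs : List Cmd} {ν : Val}
    (h : Big library (.call decodegmw [e]) cs ν) :
    ∃ cs₁ ν₁ cs₂, Big library e cs₁ ν₁ ∧ cs = cs₁ ++ cs₂ ∧
      ∀ c, ν₁ = .field (.msg c) → cs₂ = decodeCmds c := by
  obtain ⟨_, νs, hl, hlen, cs₃, hb, rfl⟩ :=
    (big_library_call_iff (fn := decodeDecl) (by simp [library])).mp h
  simp only [bigList_cons_iff, bigList_nil_iff] at hl
  obtain ⟨cs₁, ν₁, h₁, _, _, ⟨rfl, rfl⟩, rfl, rfl⟩ := hl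
  refine ⟨cs₁, ν₁, cs₃, h₁, by simp, ?_⟩
  rintro c rfl
  simp [bigList_cons_iff, bigList_nil_iff, big_val_iff, cl, str, reveal, output, p,
    decodeDecl, Exp.substAll, Exp.subst, Exp.substList, GMW.xor, big_seq_iff, big_op_iff,
    Op.apply] at hb
  simp [decodeCmds, hb]

/-- A circuit evaluates to a wire and emits the commands of a list of gates. -/
theorem IsWireCircuit.compile {K : Set String} {e : Exp} {ws : List String}
    (h : IsWireCircuit K e ws) : ∀ {cs : List Cmd} {ν : Val}, Big library e cs ν →
      ∃ gs c, cs = gs.flatMap Gate.cmds ∧ ν = .field (.msg c) ∧ (gs.map Gate.name).Perm ws ∧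
        Wired K gs ∧ c ∈ K ∪ {w | w ∈ gs.map Gate.name} := by
  -- The argument common to both binary gates: the subcircuits are compiled from left to right, and
  -- the new gate is appended with their output wires as inputs.
  have gate : ∀ (fn : FnDecl) (G : String → String → String → Gate), fn ∈ library →
      (∀ z a b cs ν, Big library (fn.body.substAll
        (fn.params.zip [.str z, .field (.msg a), .field (.msg b)])) cs ν →
          cs = (G z a b).cmds ∧ ν = .field (.msg z)) →
      (∀ z a b, (G z a b).name = z ∧ (G z a b).refs = [a, b] ∧ (G z a b).Valid) →
      ∀ (z : String) (e₁ e₂ : Exp) (ws₁ ws₂ : List String),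
      (∀ {cs : List Cmd} {ν : Val}, Big library e₁ cs ν →
        ∃ gs c, cs = gs.flatMap Gate.cmds ∧ ν = .field (.msg c) ∧ (gs.map Gate.name).Perm ws₁ ∧
          Wired K gs ∧ c ∈ K ∪ {w | w ∈ gs.map Gate.name}) →
      (∀ {cs : List Cmd} {ν : Val}, Big library e₂ cs ν →
        ∃ gs c, cs = gs.flatMap Gate.cmds ∧ ν = .field (.msg c) ∧ (gs.map Gate.name).Perm ws₂ ∧
          Wired K gs ∧ c ∈ K ∪ {w | w ∈ gs.map Gate.name}) →
      ∀ {cs : List Cmd} {ν : Val}, Big library (.call fn.name [str z, e₁, e₂]) cs ν →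
        ∃ gs c, cs = gs.flatMap Gate.cmds ∧ ν = .field (.msg c) ∧
          (gs.map Gate.name).Perm (z :: (ws₁ ++ ws₂)) ∧
          Wired K gs ∧ c ∈ K ∪ {w | w ∈ gs.map Gate.name} := by
    intro fn G hfn hbody hG z e₁ e₂ ws₁ ws₂ ih₁ ih₂ cs ν hb
    obtain ⟨cs₁, ν₁, cs₂, ν₂, cs₃, h₁, h₂, rfl, hb⟩ := big_gate_call hfn hb
    obtain ⟨gs₁, a, rfl, rfl, hp₁, hw₁, ha⟩ := ih₁ h₁
    obtain ⟨gs₂, b, rfl, rfl, hp₂, hw₂, hb'⟩ := ih₂ h₂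
    obtain ⟨rfl, rfl⟩ := hbody z a b _ _ hb
    obtain ⟨hn, hr, hv⟩ := hG z a b
    refine ⟨gs₁ ++ gs₂ ++ [G z a b], z, by simp, rfl, ?_, ?_, by simp [hn]⟩
    -- The syntax lists the outer identifier first, but its commands are emitted last; hence a
    -- permutation instead of an equality.
    · simp only [List.map_append, List.map_cons, List.map_nil, hn]
      exact (List.perm_append_singleton _ _).trans ((hp₁.append hp₂).cons z)
    · refine (hw₁.append (hw₂.mono Set.subset_union_left)).append ⟨hv, ?_, trivial⟩
      rw [hr]
      simp only [Set.mem_union, Set.mem_ofPred_eq] at ha hb'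
      simp only [List.mem_cons, List.not_mem_nil, or_false, List.map_append, List.mem_append,
        Set.mem_union, Set.mem_ofPred_eq, forall_eq_or_imp, forall_eq]
      tauto
  induction h with
  | var y => exact fun hb => absurd hb not_big_var
  | wire w h =>
    intro cs ν hb
    obtain ⟨rfl, rfl⟩ := big_val_iff.mp hb
    exact ⟨[], w, rfl, rfl, by simp, trivial, Or.inl h⟩
  | encode w i₁ i₂ h =>
    intro cs ν hb
    obtain ⟨rfl, rfl⟩ := big_encode hb
    exact ⟨[.enc w i₁ i₂], w, by simp, rfl, by simp [Gate.name], ⟨h, by simp [Gate.refs], trivial⟩,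
      by simp [Gate.name]⟩
  | and z e₁ e₂ ws₁ ws₂ _ _ ih₁ ih₂ =>
    exact gate andDecl .and (by simp [library]) (fun _ _ _ _ _ => big_and_body)
      (fun _ _ _ => ⟨rfl, rfl, trivial⟩) z e₁ e₂ ws₁ ws₂ ih₁ ih₂
  | xor z e₁ e₂ ws₁ ws₂ _ _ ih₁ ih₂ =>
    exact gate xorDecl .xor (by simp [library]) (fun _ _ _ _ _ => big_xor_body)
      (fun _ _ _ => ⟨rfl, rfl, trivial⟩) z e₁ e₂ ws₁ ws₂ ih₁ ih₂

/-- A program emits the protocol of a straight-line circuit. -/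
theorem IsWireProgram.compile {n : ℕ} : ∀ {K : Set String} {e : Exp} {ws : List String},
    IsWireProgram K n e ws → ∀ {cs : List Cmd} {ν : Val}, Big library e cs ν →
    ∃ gs c, cs = circuitProtocol gs c ∧ (gs.map Gate.name).Perm ws ∧
      Wired K gs ∧ c ∈ K ∪ {w | w ∈ gs.map Gate.name} := by
  -- The body of a `let` after substitution is not a subterm of the program, so the induction is on
  -- the number of bindings.
  induction n with
  | zero =>
    rintro K _ ws ⟨e, _, h⟩ cs ν hb
    obtain ⟨cs₁, ν₁, cs₂, h₁, rfl, h₂⟩ := big_decode hb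
    obtain ⟨gs, c, rfl, rfl, hp, hw, hc⟩ := h.compile h₁
    exact ⟨gs, c, by rw [h₂ c rfl, circuitProtocol], hp, hw, hc⟩
  | succ n ih =>
    intro K _ ws h cs ν hb
    cases h with
    | letIn _ y e₁ e₂ ws₁ ws₂ h₁ h₂ =>
    obtain ⟨cs₁, ν₁, hb₁, cs₂, hb₂, rfl⟩ := big_letIn_iff.mp hb
    obtain ⟨gs₁, a, rfl, rfl, hp₁, hw₁, ha⟩ := h₁.compile hb₁
    obtain ⟨gs₂, c, rfl, hp₂, hw₂, hc⟩ :=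
      ih ((h₂.mono Set.subset_union_left).subst y ha) hb₂
    refine ⟨gs₁ ++ gs₂, c, by simp [circuitProtocol], by simpa using hp₁.append hp₂,
      hw₁.append hw₂, ?_⟩
    simpa [or_assoc] using hc

theorem IsGMWCircuit.compile {e : Exp} (he : IsGMWCircuit e) {π : Protocol} {ν : Val}
    (h : Relation.ReflTransGen (Prelude.Step library) ([], e) (π, .val ν)) :
    ∃ gs c, π = circuitProtocol gs c ∧ (gs.map Gate.name).Nodup ∧ Wired ∅ gs ∧
      c ∈ gs.map Gate.name := by
  obtain ⟨ws, hp, hnd⟩ := he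
  obtain ⟨n, hp⟩ := hp.isWireProgram ∅
  obtain ⟨gs, c, hπ, hperm, hw, hc⟩ := hp.compile (big_of_steps h)
  exact ⟨gs, c, hπ, hperm.nodup_iff.mpr hnd, hw, by simpa using hc⟩

end GMW

-- Runs as solutions of a system of equations

namespace Overture

/-- The value of an expression in a total memory. -/
def FieldExp.value (F : Var → F2) : FieldExp → Client → F2
  | .const v, _ => v
  | .secret w, ι => F (.secret w ι)
  | .flip w, ι => F (.flip w ι)
  | .msg w, ι => F (.msg w ι)
  | .pub w, _ => F (.pub w)
  | .add ε₁ ε₂, ι => ε₁.value F ι + ε₂.value F ι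
  | .sub ε₁ ε₂, ι => ε₁.value F ι - ε₂.value F ι
  | .mul ε₁ ε₂, ι => ε₁.value F ι * ε₂.value F ι
  | .ot ε₁ ι₁ ε₂ ε₃, ι => if ε₁.value F ι₁ = 1 then ε₂.value F ι else ε₃.value F ι

/-- The memory with domain `X` that agrees with `F` on `X`. -/
def Mem.ofFun (X : Finset Var) (F : Var → F2) : Mem := fun x => if x ∈ X then some (F x) else none

theorem Mem.ofFun_mem_mems (X : Finset Var) (F : Var → F2) : Mem.ofFun X F ∈ mems X := by
  rw [mem_mems]
  ext x
  simp [Mem.dom, Mem.ofFun]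

theorem Mem.ofFun_congr {X : Finset Var} {F G : Var → F2} :
    Mem.ofFun X F = Mem.ofFun X G ↔ ∀ x ∈ X, F x = G x := by
  constructor
  · intro h x hx
    simpa [Mem.ofFun, hx] using congrFun h x
  · intro h
    funext x
    by_cases hx : x ∈ X <;> simp [Mem.ofFun, hx, h]

theorem exists_ofFun {X : Finset Var} {m : Mem} (h : m ∈ mems X) :
    ∃ F, m = Mem.ofFun X F := by
  rw [mem_mems] at h
  refine ⟨fun x => (m x).getD 0, funext fun x => ?_⟩
  have hx : m x ≠ none ↔ x ∈ X := by
    have := Set.ext_iff.mp h x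
    simpa [Mem.dom] using this
  by_cases hX : x ∈ X
  · obtain ⟨v, hv⟩ := Option.ne_none_iff_exists'.mp (hx.mpr hX)
    simp [Mem.ofFun, hX, hv]
  · simpa [Mem.ofFun, hX] using hx

theorem FieldExp.value_congr {F G : Var → F2} (ε : FieldExp) :
    ∀ ι, (∀ x ∈ ε.vars ι, F x = G x) → ε.value F ι = ε.value G ι := by
  induction ε with
  | const v => simp [FieldExp.value]
  | secret w | flip w | msg w | pub w => simp [FieldExp.value, FieldExp.vars]
  | add ε₁ ε₂ ih₁ ih₂ | sub ε₁ ε₂ ih₁ ih₂ | mul ε₁ ε₂ ih₁ ih₂ =>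
    intro ι h
    simp only [FieldExp.vars, Finset.mem_union] at h
    simp only [FieldExp.value, ih₁ ι fun x hx => h x (.inl hx), ih₂ ι fun x hx => h x (.inr hx)]
  | ot ε₁ ι₁ ε₂ ε₃ ih₁ ih₂ ih₃ =>
    intro ι h
    simp only [FieldExp.vars, Finset.mem_union] at h
    simp only [FieldExp.value, ih₁ ι₁ fun x hx => h x (.inl hx),
      ih₂ ι fun x hx => h x (.inr (.inl hx)), ih₃ ι fun x hx => h x (.inr (.inr hx))]

theorem FieldExp.eval_ofFun {X : Finset Var} {F : Var → F2} (ε : FieldExp) :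
    ∀ ι, ε.vars ι ⊆ X → ε.eval (Mem.ofFun X F) ι = some (ε.value F ι) := by
  induction ε with
  | const v => simp [FieldExp.value, FieldExp.eval]
  | secret w | flip w | msg w | pub w =>
    intro ι h
    simp only [FieldExp.vars, Finset.singleton_subset_iff] at h
    simp [FieldExp.value, FieldExp.eval, Mem.ofFun, h]
  | add ε₁ ε₂ ih₁ ih₂ | sub ε₁ ε₂ ih₁ ih₂ | mul ε₁ ε₂ ih₁ ih₂ =>
    intro ι h
    simp only [FieldExp.vars, Finset.union_subset_iff] at h
    simp [FieldExp.value, FieldExp.eval, ih₁ ι h.1, ih₂ ι h.2]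
  | ot ε₁ ι₁ ε₂ ε₃ ih₁ ih₂ ih₃ =>
    intro ι h
    simp only [FieldExp.vars, Finset.union_subset_iff] at h
    simp [FieldExp.value, FieldExp.eval, ih₁ ι₁ h.1, ih₂ ι h.2.1, ih₃ ι h.2.2]

/-- `F` satisfies the equation of every command of `π`. -/
def Solves (F : Var → F2) (π : Protocol) : Prop :=
  ∀ c ∈ π, F c.target = c.expr.value F c.client

/-- Starting from the domain `X`, every command of `π` assigns a fresh variable and uses defined
variables only. -/
def Executable : Finset Var → Protocol → Prop
  | _, [] => True
  | X, c :: π => c.target ∉ X ∧ c.expr.vars c.client ⊆ X ∧ Executable (insert c.target X) π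

def targets (π : Protocol) : Finset Var := (π.map Cmd.target).toFinset

theorem Mem.extend_ofFun (X : Finset Var) (F : Var → F2) (x : Var) (v : F2) :
    (Mem.ofFun X F).extend x v = Mem.ofFun (insert x X) (Function.update F x v) := by
  funext y
  by_cases hy : y = x
  · subst hy
    simp [Mem.extend, Mem.ofFun]
  · simp [Mem.extend, Mem.ofFun, hy]

/-- Execution writes each computed value into the total memory. Targets are fresh, so no equation
already satisfied is disturbed later. -/
theorem Executable.exists_solves {X : Finset Var} {π : Protocol} (h : Executable X π)
    (F : Var → F2) : ∃ G, (∀ x ∈ X, G x = F x) ∧ Solves G π ∧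
      Relation.ReflTransGen Step (Mem.ofFun X F, π) (Mem.ofFun (X ∪ targets π) G, []) := by
  induction π generalizing X F with
  | nil => exact ⟨F, fun _ _ => rfl, by simp [Solves], by simpa [targets] using .refl⟩
  | cons c π ih =>
    obtain ⟨hfresh, hvars, h⟩ := h
    obtain ⟨G, hG, hs, hr⟩ := ih h (Function.update F c.target (c.expr.value F c.client))
    have hX : ∀ x ∈ X, G x = F x := fun x hx => by
      rw [hG x (Finset.mem_insert_of_mem hx), Function.update_of_ne]
      rintro rfl
      exact hfresh hx
    refine ⟨G, hX, ?_, ?_⟩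
    · rintro c' (_ | ⟨_, hc'⟩)
      · rw [hG _ (Finset.mem_insert_self _ _), Function.update_self]
        exact c.expr.value_congr _ fun x hx => (hX x (hvars hx)).symm
      · exact hs c' hc'
    · refine .head (Step.assign _ c π _ (by simp [Mem.ofFun, hfresh])
        (c.expr.eval_ofFun _ hvars)) ?_
      rw [Mem.extend_ofFun]
      convert hr using 3
      ext x
      simp [targets, or_left_comm]

/-- Expressions read defined variables only, so the equations determine the targets one after
another from the values on `X`. -/
theorem Solves.eq_on {X : Finset Var} {π : Protocol} (h : Executable X π) {F G : Var → F2}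
    (hF : Solves F π) (hG : Solves G π) (hX : ∀ x ∈ X, F x = G x) :
    ∀ x ∈ X ∪ targets π, F x = G x := by
  induction π generalizing X with
  | nil => simpa [targets] using hX
  | cons c π ih =>
    obtain ⟨-, hvars, h⟩ := h
    intro x hx
    refine ih h (fun c' hc' => hF c' (.tail _ hc')) (fun c' hc' => hG c' (.tail _ hc')) ?_ x ?_
    · rw [Finset.forall_mem_insert]
      refine ⟨?_, hX⟩
      rw [hF c (.head _), hG c (.head _)]
      exact c.expr.value_congr _ fun x hx => hX x (hvars hx)
    · simpa [targets, or_left_comm] using hx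

theorem Step.deterministic {a b c : Mem × Protocol} (hb : Step a b) (hc : Step a c) : b = c := by
  cases hb
  cases hc
  simp_all

theorem steps_deterministic {a : Mem × Protocol} {M M' : Mem}
    (h : Relation.ReflTransGen Step a (M, [])) (h' : Relation.ReflTransGen Step a (M', [])) :
    M = M' := by
  induction h using Relation.ReflTransGen.head_induction_on with
  | refl =>
    rcases h'.cases_head with h' | ⟨b, hb, -⟩
    · cases h'
      rfl
    · cases hb
  | head hab _ ih =>
    rcases h'.cases_head with rfl | ⟨b, hb, hr⟩
    · cases hab
    · cases hab.deterministic hb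
      exact ih hr

theorem Executable.vars_subset {X : Finset Var} {π : Protocol} (h : Executable X π) :
    vars π ⊆ X ∪ targets π := by
  induction π generalizing X with
  | nil => simp [vars]
  | cons c π ih =>
    obtain ⟨-, hvars, h⟩ := h
    intro x hx
    simp only [vars, Finset.mem_union, Finset.mem_insert] at hx
    have := @ih _ h x
    simp only [targets, Finset.mem_union, Finset.mem_insert, List.map_cons, List.toFinset_cons]
      at this ⊢
    rcases hx with (hx | hx) | hx
    · exact .inr (.inl hx)
    · exact .inl (hvars hx)
    · tauto

theorem targets_subset_vars (π : Protocol) : targets π ⊆ vars π := by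
  induction π with
  | nil => simp [targets]
  | cons c π ih =>
    intro x hx
    simp only [targets, List.map_cons, List.toFinset_cons, Finset.mem_insert] at hx
    simp only [vars, Finset.mem_union, Finset.mem_insert]
    rcases hx with hx | hx
    · exact .inl (.inl hx)
    · exact .inr (ih hx)

theorem Executable.vars_eq {π : Protocol} (h : Executable (flips π ∪ secrets π) π) :
    flips π ∪ secrets π ∪ targets π = vars π := by
  refine (Finset.union_subset (Finset.union_subset ?_ ?_) (targets_subset_vars π)).antisymm
    h.vars_subset
  · exact Finset.filter_subset _ _
  · exact Finset.filter_subset _ _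

theorem union_ofFun (X Y : Finset Var) (F G : Var → F2) :
    (Mem.ofFun X F).union (Mem.ofFun Y G) =
      Mem.ofFun (X ∪ Y) fun x => if x ∈ X then F x else G x := by
  funext x
  by_cases hx : x ∈ X <;> by_cases hy : x ∈ Y <;> simp [Mem.union, Mem.ofFun, hx, hy]

/-- The runs of an executable protocol are the solutions of its equations. -/
theorem Executable.mem_runs {π : Protocol} (h : Executable (flips π ∪ secrets π) π) {M : Mem} :
    M ∈ runs π ↔ ∃ G, Solves G π ∧ M = Mem.ofFun (vars π) G := by
  constructor
  · rintro ⟨m₁, h₁, m₂, h₂, hr⟩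
    obtain ⟨F₁, rfl⟩ := exists_ofFun h₁
    obtain ⟨F₂, rfl⟩ := exists_ofFun h₂
    rw [union_ofFun] at hr
    obtain ⟨G, -, hG, hr'⟩ := h.exists_solves fun x => if x ∈ flips π then F₁ x else F₂ x
    rw [h.vars_eq] at hr'
    exact ⟨G, hG, steps_deterministic hr hr'⟩
  · rintro ⟨G, hG, rfl⟩
    refine ⟨_, Mem.ofFun_mem_mems _ G, _, Mem.ofFun_mem_mems _ G, ?_⟩
    rw [union_ofFun]
    simp only [ite_self]
    obtain ⟨G', hGG', hG', hr⟩ := h.exists_solves G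
    convert hr using 2
    rw [h.vars_eq, Mem.ofFun_congr, ← h.vars_eq]
    exact Solves.eq_on h hG hG' fun x hx => (hGG' x hx).symm

theorem Executable.append {X : Finset Var} {π π' : Protocol} (h : Executable X π)
    (h' : Executable (X ∪ targets π) π') : Executable X (π ++ π') := by
  induction π generalizing X with
  | nil => simpa [targets] using h'
  | cons c π ih =>
    refine ⟨h.1, h.2.1, ih h.2.2 ?_⟩
    convert h' using 1
    ext x
    simp [targets, or_left_comm]

theorem mem_vars_iff {π : Protocol} {x : Var} :
    x ∈ vars π ↔ ∃ c ∈ π, x = c.target ∨ x ∈ c.expr.vars c.client := by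
  induction π with
  | nil => simp [vars]
  | cons c π ih => simp [vars, ih, or_assoc]

end Overture

-- Executability and variables of circuit protocols

namespace GMW

open Overture

/-- Induction along the wiring: a property that passes from the inputs of each gate to its output
holds on all wires. -/
theorem Wired.induction {P : String → Prop} {K : Set String} {gs : List Gate} (h : Wired K gs)
    (hK : ∀ w ∈ K, P w) (step : ∀ g ∈ gs, (∀ a ∈ g.refs, P a) → P g.name) :
    ∀ w ∈ gs.map Gate.name, P w := by
  induction gs generalizing K with
  | nil => simp
  | cons g gs ih =>
    have hg : P g.name := step g (.head _) fun a ha => hK a (h.2.1 a ha)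
    have hgs := ih h.2.2 (by simpa [hg] using hK) fun g' hg' => step g' (.tail _ hg')
    rw [List.map_cons, List.forall_mem_cons]
    exact ⟨hg, hgs⟩

theorem Wired.valid {K : Set String} {gs : List Gate} (h : Wired K gs) : ∀ g ∈ gs, g.Valid := by
  induction gs generalizing K with
  | nil => simp
  | cons g gs ih =>
    rw [List.forall_mem_cons]
    exact ⟨h.1, ih h.2.2⟩

theorem Gate.mem_targets {g : Gate} (hg : g.Valid) {x : Var} :
    x ∈ targets g.cmds ↔ x = .msg g.name 1 ∨ x = .msg g.name 2 := by
  cases g with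
  | enc w i₁ i₂ =>
    rcases hg with ⟨rfl, rfl⟩ | ⟨rfl, rfl⟩ <;> simp [targets, Gate.cmds, Cmd.target, Gate.name]
    exact or_comm
  | and z a b =>
    simp [targets, Gate.cmds, Cmd.target, Gate.name]
    exact or_comm
  | xor z a b => simp [targets, Gate.cmds, Cmd.target, Gate.name]

theorem mem_targets_flatMap {gs : List Gate} (hgs : ∀ g ∈ gs, g.Valid) {x : Var} :
    x ∈ targets (gs.flatMap Gate.cmds) ↔
      ∃ w ∈ gs.map Gate.name, x = .msg w 1 ∨ x = .msg w 2 := by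
  have : x ∈ targets (gs.flatMap Gate.cmds) ↔ ∃ g ∈ gs, x ∈ targets g.cmds := by
    simp only [targets, List.mem_toFinset, List.mem_map, List.mem_flatMap]
    tauto
  rw [this]
  simp only [List.mem_map, exists_exists_and_eq_and]
  exact exists_congr fun g => and_congr_right fun hg => Gate.mem_targets (hgs g hg)

theorem Gate.executable {X : Finset Var} {g : Gate} (hg : g.Valid)
    (hrefs : ∀ a ∈ g.refs, Var.msg a 1 ∈ X ∧ Var.msg a 2 ∈ X)
    (hname : ∀ ι, Var.msg g.name ι ∉ X)
    (hin : ∀ c ∈ g.cmds, ∀ x ∈ c.expr.vars c.client, x.isFlip ∨ x.isSecret → x ∈ X) :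
    Executable X g.cmds := by
  cases g with
  | enc w i₁ i₂ =>
    rcases hg with ⟨rfl, rfl⟩ | ⟨rfl, rfl⟩ <;>
      simp_all [Gate.cmds, Executable, Cmd.target, Cmd.expr, Cmd.client, FieldExp.vars, Gate.name,
        Gate.refs, Var.isFlip, Var.isSecret, Finset.insert_subset_iff]
  | and z a b =>
    simp_all [Gate.cmds, Executable, Cmd.target, Cmd.expr, Cmd.client, FieldExp.vars, Gate.name,
        Gate.refs, Var.isFlip, Var.isSecret, Finset.insert_subset_iff, tableRow]
  | xor z a b =>
    simp_all [Gate.cmds, Executable, Cmd.target, Cmd.expr, Cmd.client, FieldExp.vars, Gate.name,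
        Gate.refs, Var.isFlip, Var.isSecret, Finset.insert_subset_iff]

/-- Distinct identifiers make the targets fresh, and the wiring makes the inputs defined. By `hX`,
the domain contains both shares of exactly the wires in `K`. -/
theorem Wired.executable {K : Set String} {gs : List Gate} (h : Wired K gs) {X : Finset Var}
    (hnd : (gs.map Gate.name).Nodup) (hK : ∀ w ∈ gs.map Gate.name, w ∉ K)
    (hX : ∀ w ι, Var.msg w ι ∈ X ↔ w ∈ K ∧ (ι = 1 ∨ ι = 2))
    (hin : ∀ c ∈ gs.flatMap Gate.cmds, ∀ x ∈ c.expr.vars c.client,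
      x.isFlip ∨ x.isSecret → x ∈ X) :
    Executable X (gs.flatMap Gate.cmds) := by
  induction gs generalizing K X with
  | nil => trivial
  | cons g gs ih =>
    obtain ⟨hv, hr, h⟩ := h
    rw [List.map_cons, List.nodup_cons] at hnd
    rw [List.map_cons, List.forall_mem_cons] at hK
    rw [List.flatMap_cons] at hin ⊢
    refine Executable.append ?_ (ih h hnd.2 ?_ ?_ ?_)
    · refine Gate.executable hv (fun a ha => ?_) (fun ι => ?_)
        fun c hc => hin c (List.mem_append_left _ hc)
      · simp [hX, hr a ha]
      · simp [hX, hK.1]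
    · intro w hw
      rw [Set.mem_insert_iff, not_or]
      refine ⟨?_, hK.2 w hw⟩
      rintro rfl
      exact hnd.1 hw
    · intro w ι
      rw [Finset.mem_union, Gate.mem_targets hv, hX, Set.mem_insert_iff]
      simp only [Var.msg.injEq]
      tauto
    · intro c hc x hx hx'
      exact Finset.mem_union_left _ (hin c (List.mem_append_right _ hc) x hx hx')

theorem id1_ne_id2 : id1 ≠ id2 := by decide

theorem executable_decodeCmds {X : Finset Var} {c : String}
    (hc : Var.msg c 1 ∈ X ∧ Var.msg c 2 ∈ X) (hX : ∀ x ∈ X, (∀ w, x ≠ .pub w) ∧ ∀ ι, x ≠ .out ι) :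
    Executable X (decodeCmds c) := by
  have hpub : ∀ w, Var.pub w ∉ X := fun w h => (hX _ h).1 w rfl
  have hout : ∀ ι, Var.out ι ∉ X := fun ι h => (hX _ h).2 ι rfl
  simp [decodeCmds, Executable, Cmd.target, Cmd.expr, Cmd.client, FieldExp.vars, hpub, hout, hc,
    Finset.insert_subset_iff, id1_ne_id2.symm]

section Circuit

variable {gs : List Gate} {c : String}

theorem executable_circuitProtocol (hnd : (gs.map Gate.name).Nodup) (hw : Wired ∅ gs)
    (hc : c ∈ gs.map Gate.name) :
    Executable (flips (circuitProtocol gs c) ∪ secrets (circuitProtocol gs c))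
      (circuitProtocol gs c) := by
  refine Executable.append (hw.executable hnd (by simp) ?_ ?_) (executable_decodeCmds ?_ ?_)
  · intro w ι
    simp only [flips, secrets, Finset.mem_union, Finset.mem_filter]
    simp [Var.isFlip, Var.isSecret]
  · intro d hd x hx hx'
    have : x ∈ vars (circuitProtocol gs c) :=
      mem_vars_iff.mpr ⟨d, List.mem_append_left _ hd, .inr hx⟩
    simpa [flips, secrets, this] using hx'
  · simp only [Finset.mem_union, mem_targets_flatMap hw.valid]
    exact ⟨.inr ⟨c, hc, .inl rfl⟩, .inr ⟨c, hc, .inr rfl⟩⟩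
  · intro x hx
    simp only [Finset.mem_union, mem_targets_flatMap hw.valid, flips, secrets,
      Finset.mem_filter] at hx
    constructor <;> rintro v rfl <;> simp [Var.isFlip, Var.isSecret] at hx

theorem mem_vars_circuitProtocol (hnd : (gs.map Gate.name).Nodup) (hw : Wired ∅ gs)
    (hc : c ∈ gs.map Gate.name) {x : Var} (hx : x ∈ vars (circuitProtocol gs c)) :
    x ∈ flips (circuitProtocol gs c) ∨ x ∈ secrets (circuitProtocol gs c) ∨
      (∃ w ∈ gs.map Gate.name, x = .msg w 1 ∨ x = .msg w 2) ∨
        x = .pub id1 ∨ x = .pub id2 ∨ x = .out 1 ∨ x = .out 2 := by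
  rw [← (executable_circuitProtocol hnd hw hc).vars_eq, Finset.mem_union, Finset.mem_union] at hx
  rcases hx with (hx | hx) | hx
  · exact .inl hx
  · exact .inr (.inl hx)
  · have : targets (circuitProtocol gs c) =
        targets (gs.flatMap Gate.cmds) ∪ targets (decodeCmds c) := by
      ext
      simp [targets, circuitProtocol]
    rw [this, Finset.mem_union, mem_targets_flatMap hw.valid] at hx
    refine .inr (.inr (hx.imp_right fun hx => ?_))
    simpa [targets, decodeCmds, Cmd.target] using hx

/-- The gates that use a random bit, held by client `ι`. -/
def Gate.IsLeaf (ι : Client) : Gate → Prop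
  | .enc _ _ i₂ => ι = i₂
  | .and _ _ _ => ι = 1
  | .xor _ _ _ => False

theorem Gate.IsLeaf.mem_flips {g : Gate} (hg : g ∈ gs) {ι : Client} (h : g.IsLeaf ι) :
    Var.flip g.name ι ∈ flips (circuitProtocol gs c) := by
  have : ∃ d ∈ g.cmds, Var.flip g.name ι ∈ d.expr.vars d.client := by
    cases g with
    | enc w i₁ i₂ =>
      subst h
      exact ⟨_, .head _, by simp [Cmd.expr, FieldExp.vars, Gate.name, Cmd.client]⟩
    | and z a b =>
      subst h
      exact ⟨_, .tail _ (.head _), by simp [Cmd.expr, FieldExp.vars, Gate.name, Cmd.client]⟩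
    | xor z a b => cases h
  obtain ⟨d, hd, hx⟩ := this
  exact Finset.mem_filter.mpr ⟨mem_vars_iff.mpr
    ⟨d, List.mem_append_left _ (List.mem_flatMap.mpr ⟨g, hg, hd⟩), .inr hx⟩, rfl⟩

/-- A random bit is read only by the gate bearing its identifier: at the encoding client for an
encoding, at client 1 for an `and` gate. So no randomness escapes the masks. -/
theorem exists_isLeaf {x : Var} (hx : x ∈ flips (circuitProtocol gs c)) :
    ∃ g ∈ gs, ∃ ι, g.IsLeaf ι ∧ x = .flip g.name ι := by
  obtain ⟨hv, hf⟩ := Finset.mem_filter.mp hx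
  obtain ⟨d, hd, hx⟩ := mem_vars_iff.mp hv
  rw [circuitProtocol, List.mem_append, List.mem_flatMap] at hd
  rcases hd with ⟨g, hg, hd⟩ | hd
  · refine ⟨g, hg, ?_⟩
    cases g with
    | enc w i₁ i₂ =>
      simp only [Gate.cmds, List.mem_cons, List.not_mem_nil, or_false] at hd
      rcases hd with rfl | rfl <;>
        simp [Cmd.target, Cmd.expr, Cmd.client, FieldExp.vars] at hx <;>
        rcases hx with rfl | rfl | rfl <;> simp_all [Var.isFlip, Gate.IsLeaf, Gate.name]
    | and z a b =>
      simp only [Gate.cmds, List.mem_cons, List.not_mem_nil, or_false] at hd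
      rcases hd with rfl | rfl <;>
        simp [Cmd.target, Cmd.expr, Cmd.client, FieldExp.vars, tableRow] at hx <;>
        rcases hx with rfl | rfl | rfl | rfl | rfl | rfl <;>
        simp_all [Var.isFlip, Gate.IsLeaf, Gate.name]
    | xor z a b =>
      simp only [Gate.cmds, List.mem_cons, List.not_mem_nil, or_false] at hd
      rcases hd with rfl | rfl <;>
        simp [Cmd.target, Cmd.expr, Cmd.client, FieldExp.vars] at hx <;>
        rcases hx with rfl | rfl | rfl <;> simp_all [Var.isFlip]
  · simp only [decodeCmds, List.mem_cons, List.not_mem_nil, or_false] at hd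
    rcases hd with rfl | rfl | rfl | rfl <;>
      simp [Cmd.target, Cmd.expr, Cmd.client, FieldExp.vars] at hx <;>
      rcases hx with rfl | rfl | rfl <;> simp [Var.isFlip] at hf

theorem mem_secrets_of_enc {w : String} {i₁ i₂ : Client} (hg : Gate.enc w i₁ i₂ ∈ gs) :
    Var.secret w i₂ ∈ secrets (circuitProtocol gs c) :=
  Finset.mem_filter.mpr ⟨mem_vars_iff.mpr ⟨.send w i₂ (.add (.secret w) (.flip w)) i₂,
    List.mem_append_left _ (List.mem_flatMap.mpr ⟨_, hg, .head _⟩),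
    .inr (by simp [Cmd.expr, Cmd.client, FieldExp.vars])⟩, rfl⟩

theorem owner_of_mem_secrets (hw : Wired ∅ gs) {x : Var}
    (hx : x ∈ secrets (circuitProtocol gs c)) : x.owner = some 1 ∨ x.owner = some 2 := by
  obtain ⟨hv, hf⟩ := Finset.mem_filter.mp hx
  obtain ⟨d, hd, hx⟩ := mem_vars_iff.mp hv
  rw [circuitProtocol, List.mem_append, List.mem_flatMap] at hd
  rcases hd with ⟨g, hg, hd⟩ | hd
  · have := hw.valid g hg
    cases g with
    | enc w i₁ i₂ =>
      have hi₂ : i₂ = 1 ∨ i₂ = 2 := this.symm.imp And.right And.right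
      simp only [Gate.cmds, List.mem_cons, List.not_mem_nil, or_false] at hd
      rcases hd with rfl | rfl <;>
        simp [Cmd.target, Cmd.expr, Cmd.client, FieldExp.vars] at hx <;>
        rcases hx with rfl | rfl | rfl <;> simp_all [Var.isSecret, Var.owner]
    | and z a b =>
      simp only [Gate.cmds, List.mem_cons, List.not_mem_nil, or_false] at hd
      rcases hd with rfl | rfl <;>
        simp [Cmd.target, Cmd.expr, Cmd.client, FieldExp.vars, tableRow] at hx <;>
        rcases hx with rfl | rfl | rfl | rfl | rfl | rfl <;> simp_all [Var.isSecret]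
    | xor z a b =>
      simp only [Gate.cmds, List.mem_cons, List.not_mem_nil, or_false] at hd
      rcases hd with rfl | rfl <;>
        simp [Cmd.target, Cmd.expr, Cmd.client, FieldExp.vars] at hx <;>
        rcases hx with rfl | rfl | rfl <;> simp_all [Var.isSecret]
  · simp only [decodeCmds, List.mem_cons, List.not_mem_nil, or_false] at hd
    rcases hd with rfl | rfl | rfl | rfl <;>
      simp [Cmd.target, Cmd.expr, Cmd.client, FieldExp.vars] at hx <;>
      rcases hx with rfl | rfl | rfl <;> simp [Var.isSecret] at hf

-- Shares, masks and resampling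

/-- The equations of a gate. -/
def Gate.Eqns (F : Var → F2) : Gate → Prop
  | .enc w i₁ i₂ => F (.msg w i₂) = F (.secret w i₂) + F (.flip w i₂) ∧
      F (.msg w i₁) = F (.flip w i₂)
  | .and z a b => F (.msg z 1) = F (.flip z 1) ∧ F (.msg z 2) = F (.flip z 1) +
      (F (.msg a 1) + F (.msg a 2)) * (F (.msg b 1) + F (.msg b 2))
  | .xor z a b => F (.msg z 1) = F (.msg a 1) + F (.msg b 1) ∧
      F (.msg z 2) = F (.msg a 2) + F (.msg b 2)

/-- Correctness of the one-out-of-four transfer. Here `x₁`, `y₁` are the sender's shares and `x₂`,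
`y₂` the receiver's; the latter select the row whose constants equal them, which is the product of
the plaintexts masked by `r`. -/
theorem ot4_value (r x₁ x₂ y₁ y₂ : F2) :
    (if x₂ = 1 then
      if y₂ = 1 then r + (x₁ + 1) * (y₁ + 1) else r + (x₁ + 1) * (y₁ + 0)
    else if y₂ = 1 then r + (x₁ + 0) * (y₁ + 1) else r + (x₁ + 0) * (y₁ + 0)) =
      r + (x₁ + x₂) * (y₁ + y₂) := by
  decide +revert

theorem eqns_of_solves {F : Var → F2} (hF : Solves F (circuitProtocol gs c)) :
    ∀ g ∈ gs, g.Eqns F := by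
  intro g hg
  have h : ∀ d ∈ g.cmds, F d.target = d.expr.value F d.client := fun d hd =>
    hF d (List.mem_append_left _ (List.mem_flatMap.mpr ⟨g, hg, hd⟩))
  cases g with
  | enc w i₁ i₂ =>
    simpa [Gate.cmds, Cmd.target, Cmd.expr, Cmd.client, FieldExp.value, Gate.Eqns] using h
  | and z a b =>
    simp only [Gate.cmds, List.forall_mem_cons, Cmd.target, Cmd.expr, Cmd.client, FieldExp.value,
      tableRow] at h
    exact ⟨h.2.1, h.1.trans (ot4_value _ _ _ _ _)⟩
  | xor z a b =>
    simpa [Gate.cmds, Cmd.target, Cmd.expr, Cmd.client, FieldExp.value, Gate.Eqns] using h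

theorem decode_eqns {F : Var → F2} (hF : Solves F (circuitProtocol gs c)) :
    F (.pub id1) = F (.msg c 1) ∧ F (.pub id2) = F (.msg c 2) ∧
      F (.out 1) = F (.pub id1) + F (.pub id2) ∧ F (.out 2) = F (.pub id1) + F (.pub id2) := by
  have h : ∀ d ∈ decodeCmds c, F d.target = d.expr.value F d.client := fun d hd =>
    hF d (List.mem_append_right _ hd)
  simpa [decodeCmds, Cmd.target, Cmd.expr, Cmd.client, FieldExp.value] using h

variable {F G : Var → F2}

/-- The value carried by a wire is determined by the secrets. -/
theorem plain_eq (hw : Wired ∅ gs) (hF : Solves F (circuitProtocol gs c))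
    (hG : Solves G (circuitProtocol gs c))
    (hs : ∀ x ∈ secrets (circuitProtocol gs c), F x = G x) :
    ∀ w ∈ gs.map Gate.name,
      F (.msg w 1) + F (.msg w 2) = G (.msg w 1) + G (.msg w 2) := by
  refine hw.induction (by simp) fun g hg ih => ?_
  have hF' := eqns_of_solves hF g hg
  have hG' := eqns_of_solves hG g hg
  cases g with
  | enc w i₁ i₂ =>
    have hs := hs _ (mem_secrets_of_enc hg)
    have two : ∀ x : F2, x + x = 0 := by decide
    -- The random bit occurs in both shares and cancels in characteristic 2.
    have key : ∀ K : Var → F2, (Gate.enc w i₁ i₂).Eqns K →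
        K (.msg w 1) + K (.msg w 2) = K (.secret w i₂) := by
      intro K hK
      rcases hw.valid _ hg with ⟨rfl, rfl⟩ | ⟨rfl, rfl⟩ <;> rw [hK.1, hK.2] <;>
        linear_combination two (K (.flip w _))
    simp only [Gate.name]
    rw [key F hF', key G hG', hs]
  | and z a b =>
    have two : ∀ x : F2, x + x = 0 := by decide
    have ha := ih a (by simp [Gate.refs])
    have hb := ih b (by simp [Gate.refs])
    have key : ∀ K : Var → F2, (Gate.and z a b).Eqns K → K (.msg z 1) + K (.msg z 2) =
        (K (.msg a 1) + K (.msg a 2)) * (K (.msg b 1) + K (.msg b 2)) := by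
      intro K hK
      rw [hK.1, hK.2]
      linear_combination two (K (.flip z 1))
    simp only [Gate.name]
    rw [key F hF', key G hG', ha, hb]
  | xor z a b =>
    have ha := ih a (by simp [Gate.refs])
    have hb := ih b (by simp [Gate.refs])
    simp only [Gate.name]
    rw [hF'.1, hF'.2, hG'.1, hG'.2]
    linear_combination ha + hb

/-- The difference of a share and the random bit of its gate is determined by the secrets. -/
theorem mask_eq (hw : Wired ∅ gs) (hF : Solves F (circuitProtocol gs c))
    (hG : Solves G (circuitProtocol gs c))
    (hs : ∀ x ∈ secrets (circuitProtocol gs c), F x = G x) {j : Client} (hj : j = 1 ∨ j = 2)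
    {g : Gate} (hg : g ∈ gs) {ι : Client} (hι : g.IsLeaf ι) :
    F (.msg g.name j) + F (.flip g.name ι) = G (.msg g.name j) + G (.flip g.name ι) := by
  have two : ∀ x : F2, x + x = 0 := by decide
  have hF' := eqns_of_solves hF g hg
  have hG' := eqns_of_solves hG g hg
  have hp := plain_eq hw hF hG hs g.name (List.mem_map_of_mem hg)
  cases g with
  | enc w i₁ i₂ =>
    obtain rfl : ι = i₂ := hι
    have hs := hs _ (mem_secrets_of_enc hg)
    simp only [Gate.name]
    have : j = i₁ ∨ j = ι := by
      rcases hw.valid _ hg with ⟨rfl, rfl⟩ | ⟨rfl, rfl⟩ <;> tauto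
    rcases this with rfl | rfl
    · rw [hF'.2, hG'.2, two, two]
    · rw [hF'.1, hG'.1, hs, add_assoc, two, add_assoc, two]
  | and z a b =>
    obtain rfl : ι = 1 := hι
    simp only [Gate.name] at hp ⊢
    rcases hj with rfl | rfl
    · rw [hF'.1, hG'.1, two, two]
    -- The share of client 1 is the random bit itself, so the quantity in question is the plaintext
    -- of the wire.
    · rw [← hF'.1, ← hG'.1]
      linear_combination hp
  | xor z a b => cases hι

/-- Solutions with equal random bits masked out have equal shares. -/
theorem share_eq (hw : Wired ∅ gs) (hF : Solves F (circuitProtocol gs c))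
    (hG : Solves G (circuitProtocol gs c)) {j : Client} (hj : j = 1 ∨ j = 2)
    (hleaf : ∀ g ∈ gs, ∀ ι, g.IsLeaf ι → F (.msg g.name j) = G (.msg g.name j)) :
    ∀ w ∈ gs.map Gate.name, F (.msg w j) = G (.msg w j) := by
  refine hw.induction (by simp) fun g hg ih => ?_
  have hF' := eqns_of_solves hF g hg
  have hG' := eqns_of_solves hG g hg
  cases g with
  | enc w i₁ i₂ => exact hleaf _ hg i₂ rfl
  | and z a b => exact hleaf _ hg 1 rfl
  | xor z a b =>
    have ha := ih a (by simp [Gate.refs])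
    have hb := ih b (by simp [Gate.refs])
    simp only [Gate.name]
    rcases hj with rfl | rfl
    · rw [hF'.1, hG'.1, ha, hb]
    · rw [hF'.2, hG'.2, ha, hb]

/-- The random bits can be resampled so that the secrets change to those of `G` while the shares of
client `j` stay those of `F`. -/
theorem exists_resampling (hnd : (gs.map Gate.name).Nodup) (hw : Wired ∅ gs)
    (hc : c ∈ gs.map Gate.name) (hF : Solves F (circuitProtocol gs c))
    (hG : Solves G (circuitProtocol gs c)) {j : Client} (hj : j = 1 ∨ j = 2) :
    ∃ K, Solves K (circuitProtocol gs c) ∧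
      (∀ x ∈ secrets (circuitProtocol gs c), K x = G x) ∧
        ∀ w ∈ gs.map Gate.name, K (.msg w j) = F (.msg w j) := by
  have two : ∀ x : F2, x + x = 0 := by decide
  -- With the secrets of `G`, share plus mask must be the same for `K` as for `G`; solving for the
  -- mask that gives the share of `F` yields the bit chosen here.
  obtain ⟨K, hK, hKs, -⟩ := (executable_circuitProtocol hnd hw hc).exists_solves fun x =>
    match x with
    | .flip w ι => F (.msg w j) + G (.msg w j) + G (.flip w ι)
    | x => G x
  have hsec : ∀ x ∈ secrets (circuitProtocol gs c), K x = G x := by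
    intro x hx
    rw [hK x (Finset.mem_union_right _ hx)]
    have := (Finset.mem_filter.mp hx).2
    cases x <;> simp_all [Var.isSecret]
  refine ⟨K, hKs, hsec, share_eq hw hKs hF hj fun g hg ι hι => ?_⟩
  have hm := mask_eq hw hKs hG hsec hj hg hι
  rw [hK _ (Finset.mem_union_left _ (hι.mem_flips hg))] at hm
  dsimp only at hm
  linear_combination hm - two (F (.msg g.name j))

/-- The secrets and the shares of one client determine a run. -/
theorem solution_unique (hnd : (gs.map Gate.name).Nodup) (hw : Wired ∅ gs)
    (hc : c ∈ gs.map Gate.name) (hF : Solves F (circuitProtocol gs c))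
    (hG : Solves G (circuitProtocol gs c))
    (hs : ∀ x ∈ secrets (circuitProtocol gs c), F x = G x) {j : Client} (hj : j = 1 ∨ j = 2)
    (hsh : ∀ w ∈ gs.map Gate.name, F (.msg w j) = G (.msg w j)) :
    ∀ x ∈ vars (circuitProtocol gs c), F x = G x := by
  have hex := executable_circuitProtocol hnd hw hc
  rw [← hex.vars_eq]
  refine hF.eq_on hex hG fun x hx => ?_
  rcases Finset.mem_union.mp hx with hx | hx
  · obtain ⟨g, hg, ι, hι, rfl⟩ := exists_isLeaf hx
    have hm := mask_eq hw hF hG hs hj hg hι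
    rwa [hsh _ (List.mem_map_of_mem hg), add_right_inj] at hm
  · exact hs x hx

/-- Both outputs are the plaintext of the output wire, which the secrets determine. -/
theorem outs_eq (hnd : (gs.map Gate.name).Nodup) (hw : Wired ∅ gs)
    (hc : c ∈ gs.map Gate.name) (hF : Solves F (circuitProtocol gs c))
    (hG : Solves G (circuitProtocol gs c))
    (hs : ∀ x ∈ secrets (circuitProtocol gs c), F x = G x) :
    ∀ x ∈ outs (circuitProtocol gs c), F x = G x := by
  intro x hx
  obtain ⟨hv, ho⟩ := Finset.mem_filter.mp hx
  have hp := plain_eq hw hF hG hs c hc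
  obtain ⟨f₁, f₂, f₃, f₄⟩ := decode_eqns hF
  obtain ⟨g₁, g₂, g₃, g₄⟩ := decode_eqns hG
  rcases mem_vars_circuitProtocol hnd hw hc hv with
    hx | hx | ⟨w, -, rfl | rfl⟩ | rfl | rfl | rfl | rfl
  · have := (Finset.mem_filter.mp hx).2
    cases x <;> simp_all [Var.isFlip, Var.isOut]
  · exact hs x hx
  · simp [Var.isOut] at ho
  · simp [Var.isOut] at ho
  · simp [Var.isOut] at ho
  · simp [Var.isOut] at ho
  · rw [f₃, g₃, f₁, f₂, g₁, g₂, hp]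
  · rw [f₄, g₄, f₁, f₂, g₁, g₂, hp]

theorem out_mem_outs : Var.out 1 ∈ outs (circuitProtocol gs c) :=
  Finset.mem_filter.mpr ⟨mem_vars_iff.mpr
    ⟨.output (.add (.pub id1) (.pub id2)) 1, by simp [circuitProtocol, decodeCmds], .inl rfl⟩, rfl⟩

/-- The public bits are the shares of the output wire and add up to the output. The share of `j` and
this sum give the other share. -/
theorem pub_eq (hnd : (gs.map Gate.name).Nodup) (hw : Wired ∅ gs)
    (hc : c ∈ gs.map Gate.name) (hF : Solves F (circuitProtocol gs c))
    (hG : Solves G (circuitProtocol gs c))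
    (ho : ∀ x ∈ outs (circuitProtocol gs c), F x = G x) {j : Client} (hj : j = 1 ∨ j = 2)
    (hsh : ∀ w ∈ gs.map Gate.name, F (.msg w j) = G (.msg w j)) {w : String}
    (hv : Var.pub w ∈ vars (circuitProtocol gs c)) : F (.pub w) = G (.pub w) := by
  have ho := ho _ out_mem_outs
  have hsh := hsh c hc
  obtain ⟨f₁, f₂, f₃, -⟩ := decode_eqns hF
  obtain ⟨g₁, g₂, g₃, -⟩ := decode_eqns hG
  rw [f₃, g₃] at ho
  have key : F (.pub id1) = G (.pub id1) ∧ F (.pub id2) = G (.pub id2) := by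
    rcases hj with rfl | rfl
    · have h₁ : F (.pub id1) = G (.pub id1) := by rw [f₁, g₁, hsh]
      rw [h₁, add_right_inj] at ho
      exact ⟨h₁, ho⟩
    · have h₂ : F (.pub id2) = G (.pub id2) := by rw [f₂, g₂, hsh]
      rw [h₂, add_left_inj] at ho
      exact ⟨ho, h₂⟩
  rcases mem_vars_circuitProtocol hnd hw hc hv with hx | hx | ⟨w, -, hx | hx⟩ | hx | hx | hx | hx
  · exact absurd (Finset.mem_filter.mp hx).2 (by simp [Var.isFlip])
  · exact absurd (Finset.mem_filter.mp hx).2 (by simp [Var.isSecret])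
  · cases hx
  · cases hx
  · rw [hx, key.1]
  · rw [hx, key.2]
  · cases hx
  · cases hx

theorem mem_names_of_msg (hnd : (gs.map Gate.name).Nodup) (hw : Wired ∅ gs)
    (hc : c ∈ gs.map Gate.name) {w : String} {ι : Client}
    (hv : Var.msg w ι ∈ vars (circuitProtocol gs c)) : w ∈ gs.map Gate.name := by
  rcases mem_vars_circuitProtocol hnd hw hc hv with
    hx | hx | ⟨w, hw, hx | hx⟩ | hx | hx | hx | hx
  · exact absurd (Finset.mem_filter.mp hx).2 (by simp [Var.isFlip])
  · exact absurd (Finset.mem_filter.mp hx).2 (by simp [Var.isSecret])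
  all_goals cases hx
  all_goals exact hw

end Circuit

end GMW

-- Counting runs and conditional distributions

namespace Overture

theorem Mem.restrict_eq_restrict {X : Finset Var} {m m' : Mem} :
    m.restrict X = m'.restrict X ↔ ∀ x ∈ X, m x = m' x := by
  constructor
  · intro h x hx
    simpa [Mem.restrict, hx] using congrFun h x
  · intro h
    funext x
    by_cases hx : x ∈ X <;> simp [Mem.restrict, hx, h]

theorem Mem.restrict_eq_iff {X : Finset Var} {m m' : Mem} (hm' : m' ∈ mems X) :
    m.restrict X = m' ↔ ∀ x ∈ X, m x = m' x := by
  obtain ⟨F, rfl⟩ := exists_ofFun hm'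
  have : (Mem.ofFun X F).restrict X = Mem.ofFun X F := by
    funext x
    simp +contextual [Mem.restrict, Mem.ofFun]
  rw [← this, Mem.restrict_eq_restrict, this]

theorem mem_mems_iff {X : Finset Var} {m : Mem} : m ∈ mems X ↔ ∀ x, m x ≠ none ↔ x ∈ X := by
  rw [mem_mems, Set.ext_iff]
  rfl

theorem Mem.restrict_mem_mems {X Y : Finset Var} (hXY : X ⊆ Y) {m : Mem} (hm : m ∈ mems Y) :
    m.restrict X ∈ mems X := by
  rw [mem_mems_iff] at hm ⊢
  intro x
  by_cases hx : x ∈ X <;> simp [Mem.restrict, hx]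
  exact (hm x).mpr (hXY hx)

theorem Mem.union_mem_mems {X Y : Finset Var} {m m' : Mem} (hm : m ∈ mems X) (hm' : m' ∈ mems Y) :
    m.union m' ∈ mems (X ∪ Y) := by
  obtain ⟨F, rfl⟩ := exists_ofFun hm
  obtain ⟨G, rfl⟩ := exists_ofFun hm'
  rw [union_ofFun]
  exact Mem.ofFun_mem_mems _ _

theorem Mem.union_apply_left {X : Finset Var} {m m' : Mem} (hm : m ∈ mems X) {x : Var}
    (hx : x ∈ X) : m.union m' x = m x := by
  obtain ⟨v, hv⟩ := Option.ne_none_iff_exists'.mp ((mem_mems_iff.mp hm x).mpr hx)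
  simp [Mem.union, hv]

theorem Mem.union_apply_right {X : Finset Var} {m m' : Mem} (hm : m ∈ mems X) {x : Var}
    (hx : x ∉ X) : m.union m' x = m' x := by
  have : m x = none := by
    by_contra h
    exact hx ((mem_mems_iff.mp hm x).mp h)
  simp [Mem.union, this]

open Classical in
/-- The runs as a finset of memories. -/
noncomputable def runsFinset (π : Protocol) : Finset Mem :=
  (mems (vars π)).filter (· ∈ runs π)

theorem iovars_union_flips (π : Protocol) : iovars π ∪ flips π = vars π := by
  ext x
  simp only [iovars, flips, Finset.mem_union, Finset.mem_filter]
  cases x.isFlip <;> simp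

theorem mem_runsFinset {π : Protocol} (h : ∀ M ∈ runs π, M ∈ mems (vars π)) {M : Mem} :
    M ∈ runsFinset π ↔ M ∈ runs π := by
  simpa [runsFinset] using h M

open Classical in
/-- Marginals of the basic distribution count runs. -/
theorem marginal_BD {π : Protocol} (h : ∀ M ∈ runs π, M ∈ mems (vars π)) {X : Finset Var}
    {m : Mem} (hm : m ∈ mems X) :
    marginal (iovars π ∪ flips π) (BD π) X m =
      (((runsFinset π).filter fun M => ∀ x ∈ X, M x = m x).card : ℝ) *
        (1 / ((runs π).ncard : ℝ)) := by
  rw [marginal, iovars_union_flips]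
  simp only [BD]
  rw [← Finset.sum_filter, Finset.sum_const, nsmul_eq_mul]
  congr 2
  -- The summands that contribute are the completions of `m` to a run; restricting a run to the
  -- variables outside `X` is the inverse.
  refine Finset.card_bij (fun m' _ => m.union m') ?_ ?_ ?_
  · intro m' hm'
    rw [Finset.mem_filter] at hm' ⊢
    exact ⟨(mem_runsFinset h).mpr hm'.2, fun x hx => Mem.union_apply_left hm hx⟩
  · intro m₁ h₁ m₂ h₂ heq
    rw [Finset.mem_filter] at h₁ h₂
    funext x
    by_cases hx : x ∈ X
    · have h₁ := mem_mems_iff.mp h₁.1 x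
      have h₂ := mem_mems_iff.mp h₂.1 x
      simp only [Finset.mem_sdiff, hx, not_true_eq_false, and_false, iff_false, not_not] at h₁ h₂
      rw [h₁, h₂]
    · have := congrFun heq x
      rwa [Mem.union_apply_right hm hx, Mem.union_apply_right hm hx] at this
  · intro M hM
    rw [Finset.mem_filter, mem_runsFinset h] at hM
    have hM' := h M hM.1
    have key : m.union (M.restrict (vars π \ X)) = M := by
      funext x
      by_cases hx : x ∈ X
      · rw [Mem.union_apply_left hm hx, hM.2 x hx]
      · rw [Mem.union_apply_right hm hx, Mem.restrict]
        simp only [Finset.mem_sdiff, hx, not_false_eq_true, and_true, ite_eq_left_iff]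
        intro hv
        by_contra hne
        exact hv ((mem_mems_iff.mp hM' x).mp (Ne.symm hne))
    refine ⟨M.restrict (vars π \ X), ?_, key⟩
    rw [Finset.mem_filter, key]
    exact ⟨Mem.restrict_mem_mems Finset.sdiff_subset hM', hM.1⟩

/-- If the fibers of `k` in `Q` are equinumerous, and so are their intersections with `P`, then `k`
and `P` are independent on `Q`. -/
theorem card_mul_card_of_fibers {α κ : Type*} [DecidableEq κ] (Q : Finset α) (k : α → κ)
    (P : α → Prop) [DecidablePred P]
    (hQ : ∀ a ∈ Q, ∀ b ∈ Q,
      (Q.filter fun x => k x = k a).card ≤ (Q.filter fun x => k x = k b).card)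
    (hP : ∀ a ∈ Q, ∀ b ∈ Q, (Q.filter fun x => k x = k a ∧ P x).card ≤
      (Q.filter fun x => k x = k b ∧ P x).card) (i : κ) :
    (Q.filter fun x => k x = i).card * (Q.filter P).card =
      (Q.filter fun x => k x = i ∧ P x).card * Q.card := by
  by_cases hi : ∃ a ∈ Q, k a = i
  · obtain ⟨a, ha, rfl⟩ := hi
    -- Both `Q` and its part in `P` split over the image of `k` into pieces of constant size, so
    -- both sides are the product of the number of fibers and the two piece sizes.
    have h₁ : Q.card = (Q.image k).card * (Q.filter fun x => k x = k a).card := by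
      rw [Finset.card_eq_sum_card_image k Q, Finset.sum_const_nat]
      intro i hi
      obtain ⟨b, hb, rfl⟩ := Finset.mem_image.mp hi
      exact (hQ b hb a ha).antisymm (hQ a ha b hb)
    have h₂ : (Q.filter P).card =
        (Q.image k).card * (Q.filter fun x => k x = k a ∧ P x).card := by
      rw [Finset.card_eq_sum_card_fiberwise (f := k) (t := Q.image k), Finset.sum_const_nat]
      · intro i hi
        obtain ⟨b, hb, rfl⟩ := Finset.mem_image.mp hi
        rw [Finset.filter_filter]
        simp only [and_comm (a := P _)]
        exact (hP b hb a ha).antisymm (hP a ha b hb)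
      · intro x hx
        exact Finset.mem_image_of_mem k (Finset.mem_filter.mp hx).1
    rw [h₁, h₂]
    ring
  · push Not at hi
    have h₁ : (Q.filter fun x => k x = i) = ∅ := Finset.filter_false_of_mem hi
    have h₂ : (Q.filter fun x => k x = i ∧ P x) = ∅ :=
      Finset.filter_false_of_mem fun x hx h => hi x hx h.1
    simp [h₁, h₂]

/-- A protocol leaks nothing beyond its outputs to the corrupt clients if the variables `D` together
with the outputs determine the corrupt views, and the runs with given secrets correspond to those
with other secrets so that `D` is preserved. -/
theorem conditional_eq_of_resampling {π : Protocol} (hruns : ∀ M ∈ runs π, M ∈ mems (vars π))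
    {H C : Finset Client} (hHC : Disjoint H C)
    (hown : ∀ x ∈ secrets π, ∃ ι ∈ H ∪ C, x.owner = some ι) (D : Set Var)
    (hresample : ∀ M ∈ runs π, ∀ M₀ ∈ runs π,
      ∃ M' ∈ runs π, (∀ x ∈ secrets π, M' x = M₀ x) ∧ ∀ x ∈ D, M x = M' x)
    (hunique : ∀ M ∈ runs π, ∀ M' ∈ runs π, (∀ x ∈ secrets π, M x = M' x) →
      (∀ x ∈ D, M x = M' x) → M = M')
    (houts : ∀ M ∈ runs π, ∀ M' ∈ runs π, (∀ x ∈ secrets π, M x = M' x) →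
      ∀ x ∈ outs π, M x = M' x)
    (hviews : ∀ M ∈ runs π, ∀ M' ∈ runs π, (∀ x ∈ outs π, M x = M' x) →
      (∀ x ∈ D, M x = M' x) → ∀ x ∈ corruptViews π H C, M x = M' x)
    {m₁ m₂ m : Mem} (hm₁ : m₁ ∈ mems (owned (secrets π) C ∪ outs π))
    (hm₂ : m₂ ∈ mems (corruptViews π H C))
    (hpos : 0 < marginal (iovars π ∪ flips π) (BD π)
        (owned (secrets π) C ∪ outs π ∪ corruptViews π H C) (m₁.union m₂))
    (hm : m ∈ mems (owned (secrets π) H)) :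
    conditional (iovars π ∪ flips π) (BD π) (owned (secrets π) H)
        (owned (secrets π) C ∪ outs π) (m.union m₁) =
      conditional (iovars π ∪ flips π) (BD π) (owned (secrets π) H)
        (owned (secrets π) C ∪ outs π ∪ corruptViews π H C) (m.union (m₁.union m₂)) := by
  classical
  set A := owned (secrets π) C ∪ outs π with hA
  set V := corruptViews π H C with hV
  set SH := owned (secrets π) H with hSH
  -- The sets `A`, `V` and `SH` are pairwise disjoint, so in a union of memories each part can be
  -- read off without overlap.
  have hdAV : ∀ x ∈ V, x ∉ A := by
    intro x hx hx'
    simp only [hV, corruptViews, Finset.mem_filter] at hx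
    simp only [hA, owned, outs, secrets, Finset.mem_union, Finset.mem_filter] at hx'
    rcases hx.2 with ⟨w, _, _, rfl, _⟩ | ⟨w, ι, _, _, rfl, _⟩ <;>
      simp [Var.isSecret, Var.isOut] at hx'
  have hdVS : ∀ x ∈ V, x ∉ SH := by
    intro x hx hx'
    simp only [hV, corruptViews, Finset.mem_filter] at hx
    simp only [hSH, owned, secrets, Finset.mem_filter] at hx'
    rcases hx.2 with ⟨w, _, _, rfl, _⟩ | ⟨w, ι, _, _, rfl, _⟩ <;> simp [Var.isSecret] at hx'
  have hdAS : ∀ x ∈ A, x ∉ SH := by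
    intro x hx hx'
    simp only [hSH, owned, secrets, Finset.mem_filter] at hx'
    simp only [hA, owned, outs, secrets, Finset.mem_union, Finset.mem_filter] at hx
    obtain ⟨⟨-, hs⟩, ι, hι, ho⟩ := hx'
    rcases hx with ⟨-, ι', hι', ho'⟩ | ⟨-, hx⟩
    · rw [ho] at ho'
      cases ho'
      exact Finset.disjoint_left.mp hHC hι hι'
    · cases x <;> simp_all [Var.isSecret, Var.isOut]
  have hm₁₂ : m₁.union m₂ ∈ mems (A ∪ V) := Mem.union_mem_mems hm₁ hm₂
  have hr₁ : (m.union m₁).restrict A = m₁ := (Mem.restrict_eq_iff hm₁).mpr fun x hx =>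
    Mem.union_apply_right hm (hdAS x hx)
  have hr₂ : (m.union (m₁.union m₂)).restrict (A ∪ V) = m₁.union m₂ :=
    (Mem.restrict_eq_iff hm₁₂).mpr fun x hx => Mem.union_apply_right hm <| by
      rcases Finset.mem_union.mp hx with hx | hx
      exacts [hdAS x hx, hdVS x hx]
  -- In these terms the goal is an equality of two ratios: the share of `k = m` within `Q`, and
  -- within the part of `Q` that satisfies `P`. The factor `N` cancels.
  set Q := (runsFinset π).filter fun M => ∀ x ∈ A, M x = m₁ x with hQ
  set N : ℝ := 1 / ((runs π).ncard : ℝ)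
  let k : Mem → Mem := fun M => M.restrict SH
  let P : Mem → Prop := fun M => ∀ x ∈ V, M x = m₂ x
  have e₁ : marginal (iovars π ∪ flips π) (BD π) A m₁ = (Q.card : ℝ) * N :=
    marginal_BD hruns hm₁
  have e₂ : marginal (iovars π ∪ flips π) (BD π) (A ∪ V) (m₁.union m₂) =
      ((Q.filter P).card : ℝ) * N := by
    rw [marginal_BD hruns hm₁₂, hQ, Finset.filter_filter]
    congr 3
    refine Finset.filter_congr fun M _ => ?_
    rw [Finset.forall_mem_union]
    refine and_congr (forall₂_congr fun x hx => ?_) (forall₂_congr fun x hx => ?_)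
    · rw [Mem.union_apply_left hm₁ hx]
    · rw [Mem.union_apply_right hm₁ (hdAV x hx)]
  have e₃ : marginal (iovars π ∪ flips π) (BD π) (SH ∪ A) (m.union m₁) =
      ((Q.filter fun M => k M = m).card : ℝ) * N := by
    rw [marginal_BD hruns (Mem.union_mem_mems hm hm₁), hQ,
      Finset.filter_filter]
    congr 3
    refine Finset.filter_congr fun M _ => ?_
    rw [Finset.forall_mem_union, and_comm, Mem.restrict_eq_iff hm]
    refine and_congr (forall₂_congr fun x hx => ?_) (forall₂_congr fun x hx => ?_)
    · rw [Mem.union_apply_right hm (hdAS x hx)]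
    · rw [Mem.union_apply_left hm hx]
  have e₄ : marginal (iovars π ∪ flips π) (BD π) (SH ∪ (A ∪ V)) (m.union (m₁.union m₂)) =
      ((Q.filter fun M => k M = m ∧ P M).card : ℝ) * N := by
    rw [marginal_BD hruns (Mem.union_mem_mems hm hm₁₂), hQ, Finset.filter_filter]
    congr 3
    refine Finset.filter_congr fun M _ => ?_
    rw [Finset.forall_mem_union, Finset.forall_mem_union, Mem.restrict_eq_iff hm, and_left_comm]
    refine and_congr (forall₂_congr fun x hx => ?_) (and_congr (forall₂_congr fun x hx => ?_)
      (forall₂_congr fun x hx => ?_))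
    · rw [Mem.union_apply_right hm (hdAS x hx), Mem.union_apply_left hm₁ hx]
    · rw [Mem.union_apply_left hm hx]
    · rw [Mem.union_apply_right hm (hdVS x hx), Mem.union_apply_right hm₁ (hdAV x hx)]
  have hmemQ : ∀ M, M ∈ Q ↔ M ∈ runs π ∧ ∀ x ∈ A, M x = m₁ x := fun M => by
    rw [hQ, Finset.mem_filter, mem_runsFinset hruns]
  have hsec : ∀ M ∈ Q, ∀ M' ∈ Q, k M = k M' → ∀ x ∈ secrets π, M x = M' x := by
    intro M hM M' hM' hk x hx
    rw [hmemQ] at hM hM'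
    obtain ⟨ι, hι, ho⟩ := hown x hx
    rcases Finset.mem_union.mp hι with hι | hι
    · exact Mem.restrict_eq_restrict.mp hk x (Finset.mem_filter.mpr ⟨hx, ι, hι, ho⟩)
    · have : x ∈ A := Finset.mem_union_left _ (Finset.mem_filter.mpr ⟨hx, ι, hι, ho⟩)
      rw [hM.2 x this, hM'.2 x this]
  -- The resampled run has the secrets of `b`, hence its outputs, and so stays in `Q`. Since `M` and
  -- `M'` agree on outputs and on `D`, they have the same corrupt views.
  have hmove : ∀ M ∈ Q, ∀ b ∈ Q, ∃ M' ∈ Q, k M' = k b ∧ (∀ x ∈ D, M x = M' x) ∧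
      (P M → P M') := by
    intro M hM b hb
    rw [hmemQ] at hM hb
    obtain ⟨M', hM', hs, hD⟩ := hresample M hM.1 b hb.1
    have hA' : ∀ x ∈ A, M' x = m₁ x := by
      intro x hx
      rw [← hb.2 x hx]
      rcases Finset.mem_union.mp hx with hx | hx
      · exact hs x (Finset.mem_filter.mp hx).1
      · exact houts M' hM' b hb.1 hs x hx
    refine ⟨M', (hmemQ M').mpr ⟨hM', hA'⟩, ?_, hD, fun hP x hx => ?_⟩
    · exact Mem.restrict_eq_restrict.mpr fun x hx => hs x (Finset.mem_filter.mp hx).1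
    · rw [← hP x hx]
      refine (hviews M hM.1 M' hM' (fun y hy => ?_) hD x hx).symm
      rw [hM.2 y (Finset.mem_union_right _ hy), hA' y (Finset.mem_union_right _ hy)]
  have hinj : ∀ a ∈ Q, ∀ M ∈ Q, ∀ M' ∈ Q, ∀ M'' : Mem, k M = k a → k M' = k a →
      (∀ x ∈ D, M x = M'' x) → (∀ x ∈ D, M' x = M'' x) → M = M' := by
    intro a _ M hM M' hM' M'' h h' hD hD'
    exact hunique M ((hmemQ M).mp hM).1 M' ((hmemQ M').mp hM').1
      (hsec M hM M' hM' (h.trans h'.symm)) fun x hx => (hD x hx).trans (hD' x hx).symm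
  -- Agreement on `D` relates each run over `k a` to some run over `k b` by `hmove`, and no two runs
  -- over `k a` to the same one by `hinj`. This bounds one cardinality by the other, with or without
  -- `P`.
  have key := card_mul_card_of_fibers Q k P
    (fun a ha b hb => Finset.card_le_card_of_forall_subsingleton
      (fun M M' => ∀ x ∈ D, M x = M' x)
      (fun M hM => by
        rw [Finset.mem_filter] at hM
        obtain ⟨M', hM', hk, hD, -⟩ := hmove M hM.1 b hb
        exact ⟨M', Finset.mem_filter.mpr ⟨hM', hk⟩, hD⟩)
      (fun M'' _ M hM M' hM' => by
        have h := Finset.mem_filter.mp hM.1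
        have h' := Finset.mem_filter.mp hM'.1
        exact hinj a ha M h.1 M' h'.1 M'' h.2 h'.2 hM.2 hM'.2))
    (fun a ha b hb => Finset.card_le_card_of_forall_subsingleton
      (fun M M' => ∀ x ∈ D, M x = M' x)
      (fun M hM => by
        rw [Finset.mem_filter] at hM
        obtain ⟨M', hM', hk, hD, hP⟩ := hmove M hM.1 b hb
        exact ⟨M', Finset.mem_filter.mpr ⟨hM', hk, hP hM.2.2⟩, hD⟩)
      (fun M'' _ M hM M' hM' => by
        have h := Finset.mem_filter.mp hM.1
        have h' := Finset.mem_filter.mp hM'.1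
        exact hinj a ha M h.1 M' h'.1 M'' h.2.1 h'.2.1 hM.2 hM'.2)) m
  -- Positivity of the joint marginal makes both conditioning events nonempty, so neither
  -- conditional takes its default value 0.
  rw [e₂] at hpos
  have hN : N ≠ 0 := by
    rintro h
    simp [h] at hpos
  have hPc : ((Q.filter P).card : ℝ) ≠ 0 := by
    rintro h
    simp [h] at hpos
  have hQc : (Q.card : ℝ) ≠ 0 := by
    rw [Nat.cast_ne_zero] at hPc ⊢
    exact fun h => hPc (Nat.le_zero.mp (h ▸ Finset.card_filter_le Q P))
  rw [conditional, conditional, hr₁, hr₂, e₁, e₂, e₃, e₄, if_neg (mul_ne_zero hQc hN),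
    if_neg (mul_ne_zero hPc hN), mul_div_mul_right _ _ hN, mul_div_mul_right _ _ hN,
    div_eq_div_iff hQc hPc]
  exact_mod_cast key

end Overture

-- Noninterference of circuit protocols

namespace GMW

open Overture

theorem noninterference_circuitProtocol {gs : List Gate} {c : String}
    (hnd : (gs.map Gate.name).Nodup) (hw : Wired ∅ gs) (hc : c ∈ gs.map Gate.name) :
    NoninterferenceModuloOutput {1, 2} (circuitProtocol gs c) := by
  intro H C hHC hFed m₁ hm₁ m₂ hm₂ hpos m hm
  classical
  have hex := executable_circuitProtocol hnd hw hc
  -- The client whose shares are preserved is the corrupt one. If nobody is corrupt, only the public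
  -- bits are seen and either client would do; if both are, there is no honest sender and hence no
  -- message in the view.
  obtain ⟨j, hj, hjC⟩ : ∃ j, (j = 1 ∨ j = 2) ∧
      ((∀ ι ∈ C, ι = j) ∨ H = ∅) := by
    have hmem : ∀ ι, (ι ∈ H ∨ ι ∈ C) ↔ (ι = 1 ∨ ι = 2) := fun ι => by
      rw [← Finset.mem_union, hFed]
      simp
    by_cases h₁ : 1 ∈ C
    · by_cases h₂ : 2 ∈ C
      · refine ⟨1, .inl rfl, .inr (Finset.eq_empty_of_forall_notMem fun ι hι => ?_)⟩
        rcases (hmem ι).mp (.inl hι) with rfl | rfl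
        exacts [Finset.disjoint_left.mp hHC hι h₁, Finset.disjoint_left.mp hHC hι h₂]
      · refine ⟨1, .inl rfl, .inl fun ι hι => ?_⟩
        rcases (hmem ι).mp (.inr hι) with rfl | rfl
        exacts [rfl, absurd hι h₂]
    · refine ⟨2, .inr rfl, .inl fun ι hι => ?_⟩
      rcases (hmem ι).mp (.inr hι) with rfl | rfl
      exacts [absurd hι h₁, rfl]
  have hofFun : ∀ {F G : Var → F2} {X : Finset Var}, X ⊆ vars (circuitProtocol gs c) →
      ((∀ x ∈ X, Mem.ofFun (vars (circuitProtocol gs c)) F x =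
        Mem.ofFun (vars (circuitProtocol gs c)) G x) ↔ ∀ x ∈ X, F x = G x) := by
    intro F G X hX
    refine forall₂_congr fun x hx => ?_
    simp [Mem.ofFun, hX hx]
  have hSv : secrets (circuitProtocol gs c) ⊆ vars (circuitProtocol gs c) :=
    Finset.filter_subset _ _
  have hOv : outs (circuitProtocol gs c) ⊆ vars (circuitProtocol gs c) :=
    Finset.filter_subset _ _
  have hVv : corruptViews (circuitProtocol gs c) H C ⊆ vars (circuitProtocol gs c) :=
    Finset.filter_subset _ _
  have hD : ∀ {F G : Var → F2}, (∀ x ∈ {x | ∃ w, x = Var.msg w j},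
      Mem.ofFun (vars (circuitProtocol gs c)) F x =
        Mem.ofFun (vars (circuitProtocol gs c)) G x) ↔
      ∀ w ∈ gs.map Gate.name, F (.msg w j) = G (.msg w j) := by
    intro F G
    constructor
    · intro h w hwn
      have hv : Var.msg w j ∈ vars (circuitProtocol gs c) := by
        apply targets_subset_vars
        have := (mem_targets_flatMap hw.valid (x := .msg w j)).mpr
          ⟨w, hwn, by rcases hj with rfl | rfl <;> simp⟩
        simp only [targets, List.mem_toFinset, List.mem_map, circuitProtocol,
          List.mem_append] at this ⊢
        obtain ⟨d, hd, hx⟩ := this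
        exact ⟨d, .inl hd, hx⟩
      simpa [Mem.ofFun, hv] using h (.msg w j) ⟨w, rfl⟩
    -- Messages that do not occur in the protocol are undefined in both memories and agree
    -- trivially.
    · rintro h _ ⟨w, rfl⟩
      by_cases hv : Var.msg w j ∈ vars (circuitProtocol gs c)
      · simp [Mem.ofFun, hv, h w (mem_names_of_msg hnd hw hc hv)]
      · simp [Mem.ofFun, hv]
  refine conditional_eq_of_resampling ?_ hHC ?_ {x | ∃ w, x = Var.msg w j} ?_ ?_ ?_ ?_ hm₁ hm₂
    hpos hm
  · intro M hM
    obtain ⟨F, -, rfl⟩ := hex.mem_runs.mp hM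
    exact Mem.ofFun_mem_mems _ _
  · intro x hx
    rw [hFed]
    rcases owner_of_mem_secrets hw hx with h | h
    exacts [⟨1, by simp, h⟩, ⟨2, by simp, h⟩]
  · intro M hM M₀ hM₀
    obtain ⟨F, hF, rfl⟩ := hex.mem_runs.mp hM
    obtain ⟨G, hG, rfl⟩ := hex.mem_runs.mp hM₀
    obtain ⟨K, hK, hs, hsh⟩ := exists_resampling hnd hw hc hF hG hj
    exact ⟨_, hex.mem_runs.mpr ⟨K, hK, rfl⟩, (hofFun hSv).mpr hs,
      hD.mpr fun w hw => (hsh w hw).symm⟩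
  · intro M hM M' hM' hs hsh
    obtain ⟨F, hF, rfl⟩ := hex.mem_runs.mp hM
    obtain ⟨G, hG, rfl⟩ := hex.mem_runs.mp hM'
    exact Mem.ofFun_congr.mpr
      (solution_unique hnd hw hc hF hG ((hofFun hSv).mp hs) hj (hD.mp hsh))
  · intro M hM M' hM' hs
    obtain ⟨F, hF, rfl⟩ := hex.mem_runs.mp hM
    obtain ⟨G, hG, rfl⟩ := hex.mem_runs.mp hM'
    exact (hofFun hOv).mpr (outs_eq hnd hw hc hF hG ((hofFun hSv).mp hs))
  · intro M hM M' hM' ho hsh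
    obtain ⟨F, hF, rfl⟩ := hex.mem_runs.mp hM
    obtain ⟨G, hG, rfl⟩ := hex.mem_runs.mp hM'
    refine (hofFun hVv).mpr fun x hx => ?_
    obtain ⟨hv, hx⟩ := Finset.mem_filter.mp hx
    rcases hx with ⟨w, _, _, rfl, _⟩ | ⟨w, ι, _, ι', rfl, _, hι, hι'⟩
    · exact pub_eq hnd hw hc hF hG ((hofFun hOv).mp ho) hj (hD.mp hsh) hv
    · rcases hjC with hjC | rfl
      · rw [hjC ι hι]
        exact hD.mp hsh w (mem_names_of_msg hnd hw hc hv)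
      · simp at hι'

end GMW

theorem mainTheorem2 (e : Prelude.Exp) (he : GMW.IsGMWCircuit e) (π : Overture.Protocol)
    (heval : Relation.ReflTransGen (Prelude.Step GMW.library) ([], e)
      (π, Prelude.Exp.val Prelude.Val.unit)) :
    Overture.NoninterferenceModuloOutput {1, 2} π := by
  obtain ⟨gs, c, rfl, hnd, hw, hc⟩ := he.compile heval
  exact GMW.noninterference_circuitProtocol hnd hw hc
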